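/- Let $N\ge 1$, $c\in(0,1)$ with $cN>1$, and let $F_k(z)=a_kz+b_k$ ($k=1,\dots,N$) be similarities of $\mathbb C$ with $|a_k|=c$ which satisfy the open set condition: there is a non-empty bounded open set $V\subset\mathbb C$ such that the sets $F_k(V)$ are pairwise disjoint and contained in $V$. Let $E$ be the attractor of $(F_k)$, that is, the non-empty compact set with $E=\bigcup_kF_k(E)$. Assume that there is a polygonal Jordan curve $E_0$ with successive vertices $p_1,\dots,p_M$ ($M>2$, cyclic indices) such that $$E=\overline{\bigcup_{m\in\mathbb N}\bigcup_{\omega\in\{1,\dots,N\}^m}F_\omega(E_0)},\qquad F_\omega=F_{\omega_1}\circ\dots\circ F_{\omega_m},$$ and that the perimeter of $E_0$ is normalized to $2\pi$. Put $|L_j|=|p_{j+1}-p_j|$ and $\theta_j=\sum_{l<j}|L_l|$. For a word $\omega$ of length $m$, let $\mathcal C_m$ be the circle $|z|=c^m$ with the normalized measure $dt/2\pi$, and let $\mathcal H_\omega=H^2(\mathcal C_m)$ be its Hardy space, regarded as the closed subspace of $L^2(\mathcal C_m)$ spanned by the $z^k$, $k\ge 0$, whose elements are the boundary values of holomorphic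 functions on $|z|<c^m$. Let $\Pi_m:L^2(\mathcal C_m)\to\mathcal H_\omega$ be the orthogonal projection and, for a bounded measurable function $u$ on $\mathcal C_m$, let $T^{(\omega)}_u\phi=\Pi_m(u\phi)$ be the Toeplitz operator on $\mathcal H_\omega$. Let $\kappa_\omega:\mathcal C_m\to F_\omega(E_0)$ be the homeomorphism which on the arc $\{c^me^{it}:\theta_j\le t\le\theta_j+|L_j|\}$ is the Möbius map $$\kappa_{\omega j}(z)=\frac{\bigl(q_j-\tfrac{i}{\delta_j\tau_j}\bigr)z+c^me^{i\theta_j}\bigl(q_j+\tfrac{i}{\delta_j\tau_j}\bigr)}{z+c^me^{i\theta_j}},\qquad q_j=F_\omega(p_j),\quad \delta_j=(q_{j+1}-q_j)^{-1},\quad \tau_j=\tan(|L_j|/2).$$ Let $\mathcal H^\oplus=\bigoplus_{m\in\mathbb N}\bigoplus_{\omega\in\{1,\dots,N\}^m}\mathcal H_\omega$ be the Hilbert direct sum, and let $\mathcal A^\oplus$ be the algebra generated by the operators $T^\oplus_p=\bigoplus_{m}\bigoplus_{\omega}T^{(\omega)}_{p\circ\kappa_\omega}$, where $p$ runs over the polynomials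 in $z$ and $\bar z$. For sequences $(\alpha_m)$, $(\beta_m)$ of strictly positive real numbers let $\mathcal D_\omega=\alpha_mz\partial_z+\beta_m$ on $\mathcal H_\omega$, with the maximal domain of $z\partial_z$, and let $\mathcal D^\oplus=\bigoplus_m\bigoplus_\omega\mathcal D_\omega$ on the domain of the finite sums of elements of the $\operatorname{dom}(\mathcal D_\omega)$. Then: 1. for all sequences $(\alpha_m)$, $(\beta_m)$ of strictly positive real numbers, $\mathcal D^\oplus$ is essentially selfadjoint; 2. $\dim_H(E)=\dfrac{\log N}{\log(1/c)}$; 3. there are sequences $(\alpha_m)$, $(\beta_m)$ of strictly positive real numbers such that $(\mathcal A^\oplus,\mathcal H^\oplus,\overline{\mathcal D^\oplus})$ is a spectral triple of spectral dimension $\dim_H(E)$. Here $(\mathcal A,\mathcal H,\mathcal D)$ is a spectral triple if $\mathcal A$ is a unital $*$-algebra of bounded operators on $\mathcal H$, $\mathcal D$ is selfadjoint with compact resolvent, and for every $a\in\mathcal A$, $a$ maps $\operatorname{dom}(\mathcal D)$ into itself and $[\mathcal D,a]$ extends to a bounded operator on $\mathcal H$; its spectral dimension (for invertible $\mathcal D$)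 is $\inf\{s:\operatorname{Tr}|\mathcal D|^{-s}<\infty\}$. -/

import Mathlib

open MeasureTheory Set
open scoped ENNReal InnerProductSpace

noncomputable section

namespace FractalTriple

/-! ## Unbounded operators, spectral triples, spectral dimension -/

section Operators

variable {H : Type*} [NormedAddCommGroup H] [InnerProductSpace ℂ H] [CompleteSpace H]

/-- A densely defined symmetric operator whose closure is selfadjoint. -/
structure IsEssentiallySelfAdjoint (D : H →ₗ.[ℂ] H) : Prop where
  dense_domain : Dense (D.domain : Set H)
  symmetric : D.IsFormalAdjoint D
  isClosable : D.IsClosable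
  isSelfAdjoint_closure : IsSelfAdjoint D.closure

/-- The bounded operator `R` is the resolvent `(D - μ)⁻¹`. -/
def IsResolventAt (D : H →ₗ.[ℂ] H) (μ : ℂ) (R : H →L[ℂ] H) : Prop :=
  (∀ v : H, ∃ h : R v ∈ D.domain, D ⟨R v, h⟩ - μ • R v = v) ∧
    ∀ v : D.domain, R (D v - μ • (v : H)) = v

/-- `(D - μ)⁻¹` is compact at every point `μ` of the resolvent set, which is not empty. -/
def HasCompactResolvent (D : H →ₗ.[ℂ] H) : Prop :=
  (∃ μ R, IsResolventAt D μ R) ∧ ∀ μ R, IsResolventAt D μ R → IsCompactOperator R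

/-- `(A, H, D)` is a (unital) spectral triple, for a unital `*`-algebra `A` of bounded operators
on `H` with its identity representation (which is faithful). -/
structure IsSpectralTriple (A : Subalgebra ℂ (H →L[ℂ] H)) (D : H →ₗ.[ℂ] H) : Prop where
  star_mem : ∀ a ∈ A, star a ∈ A
  isSelfAdjoint : IsSelfAdjoint D
  compactResolvent : HasCompactResolvent D
  map_domain : ∀ a ∈ A, ∀ v ∈ D.domain, a v ∈ D.domain
  /-- The commutator `[D, a]`, defined on the domain of `D`, extends to a bounded operator. -/
  bounded_commutator : ∀ a ∈ A, ∃ C : H →L[ℂ] H, ∀ (v : D.domain) (h : a v ∈ D.domain),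
    C v = D ⟨a v, h⟩ - a (D v)

/-- The trace of a positive bounded operator, with values in `[0, ∞]`: the supremum over all
orthonormal sets `S` of `∑ ⟨e, T e⟩` over `e ∈ S`; it is attained at every orthonormal basis. -/
def posTrace (T : H →L[ℂ] H) : ℝ≥0∞ :=
  ⨆ (S : Set H) (_ : Orthonormal ℂ ((↑) : S → H)), ∑' e : S, ENNReal.ofReal (⟪(e : H), T e⟫_ℂ).re

/-- `d` is the spectral dimension of the invertible selfadjoint operator `D`, the infimum of the
`s` with `Tr |D|⁻ˢ < ∞`. For `s > 0`, `|D|⁻ˢ` is the bounded operator `|D⁻¹|ˢ`, given by the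
functional calculus of the bounded selfadjoint operator `D⁻¹`. For `s ≤ 0` and an
infinite-dimensional `H`, the operator `|D|⁻ˢ` is bounded below by a positive constant whenever
`D` is invertible, and so has infinite trace. -/
def HasSpectralDimension (D : H →ₗ.[ℂ] H) (d : ℝ) : Prop :=
  ∃ B : H →L[ℂ] H, IsResolventAt D 0 B ∧
    IsGLB {s : ℝ | 0 < s ∧ posTrace (cfc (fun x : ℝ => |x| ^ s) B) < ⊤} d

end Operators

/-! ## Hilbert direct sums of operators -/

section DirectSum

variable {ι : Type*} {H : ι → Type*} [∀ i, NormedAddCommGroup (H i)]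
  [∀ i, InnerProductSpace ℂ (H i)]

theorem memℓp_two_map {T : ∀ i, H i →L[ℂ] H i} {C : ℝ} (hC : ∀ i, ‖T i‖ ≤ C) (v : lp H 2) :
    Memℓp (fun i => T i (v i)) 2 := by
  have h2 : (0 : ℝ) < (2 : ℝ≥0∞).toReal := by norm_num
  have hv := (lp.memℓp v).summable h2
  refine memℓp_gen (Summable.of_nonneg_of_le (fun i => by positivity) (fun i => ?_)
    (hv.mul_left (C ^ (2 : ℝ≥0∞).toReal)))
  have hC0 : 0 ≤ C := (norm_nonneg _).trans (hC i)
  rw [← Real.mul_rpow hC0 (norm_nonneg _)]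
  exact Real.rpow_le_rpow (norm_nonneg _)
    (((T i).le_opNorm _).trans (mul_le_mul_of_nonneg_right (hC i) (norm_nonneg _))) h2.le

/-- The direct sum `⨁ T i` of a uniformly bounded family of bounded operators, as a linear map. -/
def directSumₗ (T : ∀ i, H i →L[ℂ] H i) {C : ℝ} (hC : ∀ i, ‖T i‖ ≤ C) : lp H 2 →ₗ[ℂ] lp H 2 where
  toFun v := ⟨fun i => T i (v i), memℓp_two_map hC v⟩
  map_add' v w := by ext i; exact (T i).map_add (v i) (w i)
  map_smul' a v := by ext i; exact (T i).map_smul a (v i)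

theorem norm_directSumₗ_le (T : ∀ i, H i →L[ℂ] H i) {C : ℝ} (hC0 : 0 ≤ C) (hC : ∀ i, ‖T i‖ ≤ C)
    (v : lp H 2) : ‖directSumₗ T hC v‖ ≤ C * ‖v‖ := by
  have h2 : (0 : ℝ) < (2 : ℝ≥0∞).toReal := by norm_num
  refine lp.norm_le_of_tsum_le h2 (by positivity) ?_
  rw [Real.mul_rpow hC0 (norm_nonneg _), lp.norm_rpow_eq_tsum h2, ← tsum_mul_left]
  have hv := (lp.memℓp v).summable h2
  refine Summable.tsum_le_tsum (fun i => ?_) ((memℓp_two_map hC v).summable h2)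
    (hv.mul_left _)
  rw [← Real.mul_rpow hC0 (norm_nonneg _)]
  exact Real.rpow_le_rpow (norm_nonneg _)
    (((T i).le_opNorm _).trans (mul_le_mul_of_nonneg_right (hC i) (norm_nonneg _))) h2.le

open Classical in
/-- The direct sum `⨁ T i` of a uniformly bounded family of bounded operators, a bounded operator
on the Hilbert direct sum (it is `0` by convention if the family is not uniformly bounded). -/
def directSum (T : ∀ i, H i →L[ℂ] H i) : lp H 2 →L[ℂ] lp H 2 :=
  if h : ∃ C : ℝ, 0 ≤ C ∧ ∀ i, ‖T i‖ ≤ C then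
    (directSumₗ T h.choose_spec.2).mkContinuous h.choose
      (norm_directSumₗ_le T h.choose_spec.1 h.choose_spec.2)
  else 0

theorem memℓp_two_of_finite {f : ∀ i, H i} (hf : {i | f i ≠ 0}.Finite) : Memℓp f 2 :=
  (memℓp_zero hf).of_exponent_ge zero_le

theorem finite_ne_zero_map {D : ∀ i, H i →ₗ.[ℂ] H i} {v : ∀ i, H i} (hv : {i | v i ≠ 0}.Finite)
    (hD : ∀ i, v i ∈ (D i).domain) : {i | D i ⟨v i, hD i⟩ ≠ 0}.Finite := by
  refine hv.subset fun i hi h0 => hi ?_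
  have h0' : (⟨v i, hD i⟩ : (D i).domain) = 0 := Subtype.ext h0
  rw [h0', LinearPMap.map_zero]

/-- The algebraic direct sum `⨁ D i` of unbounded operators: its domain consists of the `⨁ v i`
with finitely many nonzero components `v i ∈ dom (D i)`. -/
def directSumPMap (D : ∀ i, H i →ₗ.[ℂ] H i) : lp H 2 →ₗ.[ℂ] lp H 2 where
  domain :=
    { carrier := {v | {i | v i ≠ 0}.Finite ∧ ∀ i, v i ∈ (D i).domain}
      zero_mem' := by simp
      add_mem' := by
        rintro v w ⟨hv, hv'⟩ ⟨hw, hw'⟩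
        refine ⟨(hv.union hw).subset fun i hi => ?_, fun i => add_mem (hv' i) (hw' i)⟩
        by_contra h
        simp only [mem_union, Set.mem_ofPred_eq, not_or, not_not] at h
        exact hi (by simp [h.1, h.2])
      smul_mem' := by
        rintro a v ⟨hv, hv'⟩
        refine ⟨hv.subset fun i hi h => hi ?_, fun i => Submodule.smul_mem _ a (hv' i)⟩
        simp [h] }
  toFun :=
    { toFun := fun v => ⟨fun i => D i ⟨v.1 i, v.2.2 i⟩,
        memℓp_two_of_finite (finite_ne_zero_map v.2.1 v.2.2)⟩
      map_add' := fun v w => by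
        ext i
        exact (D i).map_add ⟨v.1 i, v.2.2 i⟩ ⟨w.1 i, w.2.2 i⟩
      map_smul' := fun a v => by
        ext i
        exact (D i).map_smul a ⟨v.1 i, v.2.2 i⟩ }

end DirectSum

/-! ## Hardy spaces of circles -/

/-- The normalized arc length `dt / 2π` on the circle of centre `0` and radius `r`. -/
def circleMeasure (r : ℝ) : Measure ℂ :=
  ENNReal.ofReal (2 * Real.pi)⁻¹ • (volume.restrict (Ioc 0 (2 * Real.pi))).map (circleMap 0 r)

instance (r : ℝ) : IsFiniteMeasure (circleMeasure r) := by
  unfold circleMeasure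
  refine ⟨?_⟩
  rw [Measure.smul_apply, Measure.map_apply (continuous_circleMap 0 r).measurable .univ]
  simp [ENNReal.mul_lt_top]

theorem ae_norm_eq (r : ℝ) : ∀ᵐ z ∂circleMeasure r, ‖z‖ = |r| := by
  unfold circleMeasure
  refine Measure.ae_smul_measure ?_ _
  rw [ae_map_iff (continuous_circleMap 0 r).aemeasurable
    (measurableSet_eq_fun measurable_norm measurable_const)]
  exact .of_forall fun t => by simp

theorem memLp_pow (r : ℝ) (k : ℕ) : MemLp (fun z : ℂ => z ^ k) 2 (circleMeasure r) :=
  MemLp.of_bound (by fun_prop) (|r| ^ k) ((ae_norm_eq r).mono fun z hz => by rw [norm_pow, hz])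

/-- The Hardy space of the circle of radius `r`, as the space of boundary values: the closed
subspace of `L²(dt / 2π)` spanned by the monomials `z ^ k`, `k ≥ 0`. -/
def HardySpace (r : ℝ) : Submodule ℂ (Lp ℂ 2 (circleMeasure r)) :=
  (Submodule.span ℂ (Set.range fun k : ℕ => (memLp_pow r k).toLp)).topologicalClosure

instance (r : ℝ) : CompleteSpace (HardySpace r) :=
  inferInstanceAs (CompleteSpace (Submodule.topologicalClosure _))

/-- The holomorphic function on the disk `|z| < r` whose boundary value is `φ`, by Cauchy's
formula `φ(z) = (1 / 2πi) ∮ φ(ζ) / (ζ - z) dζ`. -/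
def holoExt {r : ℝ} (φ : HardySpace r) (z : ℂ) : ℂ :=
  ∫ ζ, φ.1 ζ * (ζ / (ζ - z)) ∂circleMeasure r

theorem integrable_cauchy {r : ℝ} (φ : HardySpace r) {z : ℂ} (hz : z ∈ Metric.ball (0 : ℂ) r) :
    Integrable (fun ζ => φ.1 ζ * (ζ / (ζ - z))) (circleMeasure r) := by
  have hz' : ‖z‖ < r := by simpa using hz
  refine ((Lp.memLp φ.1).integrable one_le_two).mul_bdd (c := r / (r - ‖z‖))
    (by fun_prop : Measurable fun ζ : ℂ => ζ / (ζ - z)).aestronglyMeasurable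
    ((ae_norm_eq r).mono fun ζ h => ?_)
  rw [abs_of_pos ((norm_nonneg z).trans_lt hz')] at h
  rw [norm_div, h]
  have h1 := norm_sub_norm_le ζ z
  rw [h] at h1
  have h2 : 0 ≤ r := (norm_nonneg z).trans hz'.le
  have h3 : 0 < r - ‖z‖ := by linarith
  gcongr

theorem holoExt_add {r : ℝ} (φ ψ : HardySpace r) {z : ℂ} (hz : z ∈ Metric.ball (0 : ℂ) r) :
    holoExt (φ + ψ) z = holoExt φ z + holoExt ψ z := by
  unfold holoExt
  rw [← integral_add (integrable_cauchy φ hz) (integrable_cauchy ψ hz)]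
  refine integral_congr_ae ?_
  filter_upwards [Lp.coeFn_add φ.1 ψ.1] with ζ h
  rw [Submodule.coe_add, h, Pi.add_apply, add_mul]

theorem holoExt_smul {r : ℝ} (a : ℂ) (φ : HardySpace r) (z : ℂ) :
    holoExt (a • φ) z = a * holoExt φ z := by
  unfold holoExt
  rw [← integral_const_mul]
  refine integral_congr_ae ?_
  filter_upwards [Lp.coeFn_smul a φ.1] with ζ h
  rw [Submodule.coe_smul, h, Pi.smul_apply, smul_eq_mul, mul_assoc]

/-- The graph of `z ∂_z`: the pairs `(φ, ψ)` with `ψ(z) = z φ'(z)` on the disk `|z| < r`. -/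
def radialGraph (r : ℝ) : Submodule ℂ (HardySpace r × HardySpace r) where
  carrier := {x | ∀ z ∈ Metric.ball (0 : ℂ) r,
    ∃ w, HasDerivAt (holoExt x.1) w z ∧ holoExt x.2 z = z * w}
  zero_mem' := by
    intro z hz
    have h0 : ∀ z, holoExt (0 : HardySpace r) z = 0 := fun z => by
      simpa using holoExt_smul 0 (0 : HardySpace r) z
    refine ⟨0, ?_, by simp [h0]⟩
    have : holoExt (0 : HardySpace r) = fun _ => 0 := funext h0
    simp only [Prod.fst_zero, this]
    exact hasDerivAt_const z 0
  add_mem' := by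
    intro x y hx hy z hz
    obtain ⟨w, hw, hw'⟩ := hx z hz
    obtain ⟨u, hu, hu'⟩ := hy z hz
    refine ⟨w + u, ?_, ?_⟩
    · refine (hw.add hu).congr_of_eventuallyEq ?_
      filter_upwards [Metric.isOpen_ball.mem_nhds hz] with z hz
      exact holoExt_add _ _ hz
    · rw [Prod.snd_add, holoExt_add _ _ hz, hw', hu', mul_add]
  smul_mem' := by
    intro a x hx z hz
    obtain ⟨w, hw, hw'⟩ := hx z hz
    refine ⟨a * w, ?_, ?_⟩
    · refine (hw.const_mul a).congr_of_eventuallyEq (.of_forall fun z => ?_)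
      exact holoExt_smul _ _ _
    · rw [Prod.smul_snd, holoExt_smul, hw', mul_left_comm]

/-- The unbounded operator `z ∂_z` on the Hardy space, with its maximal domain. -/
def radialDeriv (r : ℝ) : HardySpace r →ₗ.[ℂ] HardySpace r :=
  (radialGraph r).toLinearPMap

/-- The operator `α z ∂_z + β`, with the domain of `z ∂_z`. -/
def levelDirac (r α β : ℝ) : HardySpace r →ₗ.[ℂ] HardySpace r :=
  ((β : ℂ) • LinearMap.id : HardySpace r →ₗ[ℂ] HardySpace r) +ᵥ ((α : ℂ) • radialDeriv r)

open Classical in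
/-- The Toeplitz operator `φ ↦ Π (u φ)`, where `Π` is the orthogonal projection of `L²` onto the
Hardy space, for a bounded symbol `u` on the circle (`0` by convention for other `u`). -/
def toeplitz (r : ℝ) (u : ℂ → ℂ) : HardySpace r →L[ℂ] HardySpace r :=
  if h : MemLp u ∞ (circleMeasure r) then
    (HardySpace r).orthogonalProjectionOnto ∘L
      ((ContinuousLinearMap.mul ℂ ℂ).holderL (circleMeasure r) ∞ 2 2 h.toLp) ∘L
      (HardySpace r).subtypeL
  else 0

/-! ## Self-similar sets generated by a polygonal Jordan curve -/

/-- The composition `F_{ω₁} ∘ ⋯ ∘ F_{ωₘ}` of the maps `F_k z = a_k z + b_k` along a word. -/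
def wordMap {N : ℕ} (a b : Fin N → ℂ) : {m : ℕ} → (Fin m → Fin N) → ℂ → ℂ
  | 0, _ => id
  | _ + 1, ω => fun z => a (ω 0) * wordMap a b (Fin.tail ω) z + b (ω 0)

/-- The length of the side `L_j = [p_j, p_{j+1}]`; the indices in `Fin M` are cyclic. -/
def sideLength {M : ℕ} [NeZero M] (p : Fin M → ℂ) (j : Fin M) : ℝ := ‖p (j + 1) - p j‖

/-- The polygonal closed curve with vertices `p_j`. -/
def polygon {M : ℕ} [NeZero M] (p : Fin M → ℂ) : Set ℂ := ⋃ j, segment ℝ (p j) (p (j + 1))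

/-- The polygonal closed curve with vertices `p_j`, `j = 1, …, M`, `M > 2`, is a Jordan curve:
going once along its sides, it does not pass twice through the same point. -/
structure IsPolygonalJordan {M : ℕ} [NeZero M] (p : Fin M → ℂ) : Prop where
  two_lt : 2 < M
  injective : InjOn (fun x : Fin M × ℝ => p x.1 + (x.2 : ℂ) * (p (x.1 + 1) - p x.1))
    (univ ×ˢ Ico 0 1)

/-- The maps `F_k z = a_k z + b_k` are similarities of common ratio `c ∈ (0, 1)` which satisfy the
open set condition, `E` is their attractor, and `E` is the closure of the union of the images
`F_ω(E₀)` of the polygonal Jordan curve `E₀` with vertices `p_j`. -/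
structure IsGeneratedBy {N M : ℕ} [NeZero M] (c : ℝ) (a b : Fin N → ℂ) (p : Fin M → ℂ)
    (E : Set ℂ) : Prop where
  ratio_pos : 0 < c
  ratio_lt_one : c < 1
  ratio_eq : ∀ k, ‖a k‖ = c
  open_set_condition : ∃ V : Set ℂ, V.Nonempty ∧ IsOpen V ∧ Bornology.IsBounded V ∧
    (∀ k, (fun z => a k * z + b k) '' V ⊆ V) ∧
    Pairwise fun k l => Disjoint ((fun z => a k * z + b k) '' V) ((fun z => a l * z + b l) '' V)
  attractor_nonempty : E.Nonempty
  attractor_compact : IsCompact E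
  attractor_eq : E = ⋃ k, (fun z => a k * z + b k) '' E
  jordan : IsPolygonalJordan p
  decomposition : E = closure (⋃ (m : ℕ) (ω : Fin m → Fin N), wordMap a b ω '' polygon p)

/-- `θ_j`, the length of the curve from the first vertex to `p_j`. -/
def angle {M : ℕ} [NeZero M] (p : Fin M → ℂ) (j : Fin M) : ℝ := ∑ l ∈ Finset.Iio j, sideLength p l

/-- For a polygon with vertices `q_j` (the image of the polygon with vertices `p_j`), the Möbius
map `κ_j` sending the arc `{r e^{it} | θ_j ≤ t ≤ θ_j + |L_j|}` onto the side `[q_j, q_{j+1}]`, with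
`δ = (q_{j+1} - q_j)⁻¹` and `τ = tan (|L_j| / 2)`. -/
def kappaSide {M : ℕ} [NeZero M] (p q : Fin M → ℂ) (r : ℝ) (j : Fin M) (z : ℂ) : ℂ :=
  let δ : ℂ := (q (j + 1) - q j)⁻¹
  let τ : ℂ := (Real.tan (sideLength p j / 2) : ℝ)
  let ζ : ℂ := r * Complex.exp (Complex.I * angle p j)
  ((q j - Complex.I / (δ * τ)) * z + ζ * (q j + Complex.I / (δ * τ))) / (z + ζ)

open Classical in
/-- The homeomorphism `κ` from the circle of radius `r` onto the polygon with vertices `q_j`, equal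
to `κ_j` on the `j`-th arc. It is evaluated at `z` through the argument of `z` in `[0, 2π)`. -/
def kappa {M : ℕ} [NeZero M] (p q : Fin M → ℂ) (r : ℝ) (z : ℂ) : ℂ :=
  let t := toIcoMod Real.two_pi_pos 0 (Complex.arg z)
  ∑ j, if angle p j ≤ t ∧ t < angle p j + sideLength p j then kappaSide p q r j z else 0

/-! ## The direct sum over all words -/

/-- All words `ω ∈ {1, …, N}^m`, `m ∈ ℕ`. -/
abbrev Word (N : ℕ) : Type := (m : ℕ) × (Fin m → Fin N)

/-- `H_ω`, the Hardy space of the circle of radius `c ^ m` for a word `ω` of length `m`. -/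
abbrev WordSpace (c : ℝ) {N : ℕ} (ω : Word N) : Type := HardySpace (c ^ ω.1)

/-- The Hilbert direct sum of all `H_ω`. -/
abbrev SumSpace (c : ℝ) (N : ℕ) : Type := lp (WordSpace c (N := N)) 2

/-- `κ_ω`, from the circle of radius `c ^ m` onto `F_ω(E₀)`. -/
def wordKappa {N M : ℕ} [NeZero M] (c : ℝ) (a b : Fin N → ℂ) (p : Fin M → ℂ) (ω : Word N) :
    ℂ → ℂ :=
  kappa p (fun j => wordMap a b ω.2 (p j)) (c ^ ω.1)

/-- The function `z ↦ P(z, z̄)` on `ℂ`. -/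
def polyFun (P : MvPolynomial (Fin 2) ℂ) (z : ℂ) : ℂ := P.eval ![z, (starRingEnd ℂ) z]

/-- `T_P^⊕`, the direct sum of the Toeplitz operators with symbols `P ∘ κ_ω`. -/
def sumToeplitz {N M : ℕ} [NeZero M] (c : ℝ) (a b : Fin N → ℂ) (p : Fin M → ℂ)
    (P : MvPolynomial (Fin 2) ℂ) : SumSpace c N →L[ℂ] SumSpace c N :=
  directSum fun ω : Word N => toeplitz (c ^ ω.1) (polyFun P ∘ wordKappa c a b p ω)

/-- The algebra generated by the operators `T_P^⊕`, for all polynomials `P` in `z` and `z̄`. -/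
def sumAlgebra {N M : ℕ} [NeZero M] (c : ℝ) (a b : Fin N → ℂ) (p : Fin M → ℂ) :
    Subalgebra ℂ (SumSpace c N →L[ℂ] SumSpace c N) :=
  Algebra.adjoin ℂ (Set.range (sumToeplitz c a b p))

/-- `D^⊕`, the direct sum of the operators `D_ω = α_m z ∂_z + β_m`; its domain consists of the
finite sums of elements of the domains of the `D_ω`. -/
def sumDirac (c : ℝ) (N : ℕ) (α β : ℕ → ℝ) : SumSpace c N →ₗ.[ℂ] SumSpace c N :=
  directSumPMap fun ω : Word N => levelDirac (c ^ ω.1) (α ω.1) (β ω.1)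

end FractalTriple

end

/-!
The operator `D^⊕` is diagonal in an orthonormal basis: the normalized monomials `(z / r) ^ k` are
an orthonormal basis of the Hardy space of the circle of radius `r`, and comparing Taylor
coefficients identifies `z ∂_z`, with its maximal domain, with the operator which multiplies the
`k`-th coordinate by `k` (`isDiagonal_levelDirac`). An operator with an orthonormal basis of
eigenvectors and real eigenvalues, contained in the corresponding maximal diagonal operator, is
essentially selfadjoint, whatever the weights are. The same basis shows that the resolvent is
compact when the eigenvalues tend to infinity, and that `Tr |D|⁻ˢ` is the sum of the powers of the
eigenvalues.

The weights are `α_m = β_m = c⁻ᵐ`. The eigenvalues are then `c⁻ᵐ (k + 1)` with multiplicity `N ^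
m`, and `Tr |D|⁻ˢ = ∑ (N c ^ s) ^ m * ∑ (k + 1)⁻ˢ`, which is finite if and only if `s` exceeds
both `1` and `d = log N / log (1 / c)`; as `c N > 1`, the latter is the larger of the two
(`tsum_eigenvalue_lt_top_iff`).

The matrix entries of a Toeplitz operator in the monomial basis are the Fourier coefficients of
its symbol, so that `[z ∂_z, T_u]` is the Toeplitz operator with symbol `-i ∂_t u`. In terms of
the angle `t`, the Möbius map `κ_j` is `q_j + (q_{j+1} - q_j) tan ((t - θ_j) / 2) / tan (|L_j| /
2)`; here `|L_j| < π` because a side of a Jordan polygon is shorter than half of the perimeter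
(`sideLength_lt_half`). So `P ∘ κ_ω` is piecewise smooth and continuous, integration by parts on
the arcs leaves boundary terms which cancel cyclically (`integral_arcSum_deriv`), and since `κ_ω`
is `κ_∅` followed by a similarity of ratio `c ^ m`, its derivative is `O(c ^ m)`
(`exists_symbol`). The factor `α_m = c⁻ᵐ` compensates exactly this decay, and the commutators with
the generators are direct sums of uniformly bounded operators. The Leibniz rule extends this to
the whole algebra.

The Hausdorff measure of `E` in dimension `d` is finite because the `N ^ m` cells `F_ω(E)` have
diameter `c ^ m diam E` and `N c ^ d = 1`. It is positive by a counting argument: by the open set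
condition a set of diameter about `c ^ m` meets a bounded number of cells of level `m`, hence at
most `K N ^ (n - m)` cells of level `n`. A countable cover of `E` is enlarged to an open one and
reduced to a finite one by compactness; all `N ^ n` cells of a deep level `n` have to be counted,
which bounds `∑ N ^ (-m_i)`, and so `∑ diam ^ d`, from below
(`hausdorffMeasure_attractor_ne_zero`).
-/

noncomputable section

namespace FractalTriple

/-! ### Diagonal operators on a Hilbert space with an orthonormal basis -/

section Diagonal

variable {H : Type*} [NormedAddCommGroup H] [InnerProductSpace ℂ H] {ι : Type*}

theorem ext_inner_basis (e : HilbertBasis ι ℂ H) {v w : H} (h : ∀ i, ⟪e i, v⟫_ℂ = ⟪e i, w⟫_ℂ) :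
    v = w := by
  refine e.repr.injective (lp.ext (funext fun i => ?_))
  rw [e.repr_apply_apply, e.repr_apply_apply, h i]

theorem inner_basis_self (e : HilbertBasis ι ℂ H) (i : ι) : ⟪e i, e i⟫_ℂ = 1 := by
  rw [inner_self_eq_norm_sq_to_K, e.orthonormal.1 i]; simp

theorem inner_basis_ne (e : HilbertBasis ι ℂ H) {i j : ι} (h : i ≠ j) : ⟪e i, e j⟫_ℂ = 0 :=
  e.orthonormal.2 h

theorem hasSum_inner_map (e : HilbertBasis ι ℂ H) (T : H →L[ℂ] H) (u v : H) :
    HasSum (fun i => ⟪e i, v⟫_ℂ * ⟪u, T (e i)⟫_ℂ) ⟪u, T v⟫_ℂ := by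
  have h := (e.hasSum_repr v).mapL ((innerSL ℂ u).comp T)
  simpa [e.repr_apply_apply, inner_smul_right] using h

/-- Two bounded operators with the same matrix entries are equal. -/
theorem ext_matrix (e : HilbertBasis ι ℂ H) {S T : H →L[ℂ] H}
    (h : ∀ i j, ⟪e i, S (e j)⟫_ℂ = ⟪e i, T (e j)⟫_ℂ) : S = T := by
  ext v
  refine ext_inner_basis e fun i => ?_
  refine (hasSum_inner_map e S (e i) v).unique ?_
  simpa only [h] using hasSum_inner_map e T (e i) v

/-- The graph of the maximal operator which acts on the coordinates with respect to the basis `e`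
as multiplication by `lam`. -/
def diagGraph (e : HilbertBasis ι ℂ H) (lam : ι → ℝ) : Submodule ℂ (H × H) where
  carrier := {x | ∀ i, ⟪e i, x.2⟫_ℂ = lam i * ⟪e i, x.1⟫_ℂ}
  zero_mem' := by simp
  add_mem' := by
    intro x y hx hy i
    simp only [Prod.snd_add, Prod.fst_add, inner_add_right, hx i, hy i, mul_add]
  smul_mem' := by
    intro a x hx i
    simp only [Prod.smul_snd, Prod.smul_fst, inner_smul_right, hx i]
    ring

theorem mem_diagGraph {e : HilbertBasis ι ℂ H} {lam : ι → ℝ} {v w : H} :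
    (v, w) ∈ diagGraph e lam ↔ ∀ i, ⟪e i, w⟫_ℂ = lam i * ⟪e i, v⟫_ℂ := Iff.rfl

theorem basis_mem_diagGraph (e : HilbertBasis ι ℂ H) (lam : ι → ℝ) (i : ι) :
    (e i, (lam i : ℂ) • e i) ∈ diagGraph e lam := by
  intro j
  rw [inner_smul_right]
  by_cases h : j = i
  · rw [h]
  · simp only [inner_basis_ne e h, mul_zero]

theorem isClosed_diagGraph (e : HilbertBasis ι ℂ H) (lam : ι → ℝ) :
    IsClosed (diagGraph e lam : Set (H × H)) := by
  have : (diagGraph e lam : Set (H × H)) =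
      ⋂ i, {x : H × H | ⟪e i, x.2⟫_ℂ = lam i * ⟪e i, x.1⟫_ℂ} := by
    ext x; simp [diagGraph]
  rw [this]
  exact isClosed_iInter fun i => isClosed_eq (by fun_prop) (by fun_prop)

/-- The eigenvectors span a core of the maximal diagonal operator: the partial sums of the
expansions of `v` and `D v` approximate the pair `(v, D v)`. -/
theorem diagGraph_le_closure (e : HilbertBasis ι ℂ H) (lam : ι → ℝ) {G : Submodule ℂ (H × H)}
    (hG : ∀ i, (e i, (lam i : ℂ) • e i) ∈ G) : diagGraph e lam ≤ G.topologicalClosure := by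
  rintro ⟨v, w⟩ hvw
  have hv := e.hasSum_repr v
  have hw := e.hasSum_repr w
  refine mem_closure_of_tendsto (hv.prodMk hw) (.of_forall fun s => ?_)
  refine Submodule.sum_mem _ fun i _ => ?_
  have : (e.repr v i • e i, e.repr w i • e i) = e.repr v i • (e i, (lam i : ℂ) • e i) := by
    rw [e.repr_apply_apply, e.repr_apply_apply, mem_diagGraph.1 hvw i, Prod.smul_mk, smul_smul,
      mul_comm]
  rw [this]
  exact G.smul_mem _ (hG i)

/-- A densely defined operator which has the orthonormal basis `e` of eigenvectors with real
eigenvalues `lam`, and is a restriction of the corresponding maximal diagonal operator. -/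
structure IsDiagonal (e : HilbertBasis ι ℂ H) (lam : ι → ℝ) (D : H →ₗ.[ℂ] H) : Prop where
  basis_mem : ∀ i, (e i, (lam i : ℂ) • e i) ∈ D.graph
  graph_le : D.graph ≤ diagGraph e lam

namespace IsDiagonal

variable {e : HilbertBasis ι ℂ H} {lam : ι → ℝ} {D : H →ₗ.[ℂ] H}

theorem inner_apply (h : IsDiagonal e lam D) (v : D.domain) (i : ι) :
    ⟪e i, D v⟫_ℂ = lam i * ⟪e i, (v : H)⟫_ℂ :=
  mem_diagGraph.1 (h.graph_le (D.mem_graph v)) i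

theorem dense_domain (h : IsDiagonal e lam D) : Dense (D.domain : Set H) := by
  rw [Submodule.dense_iff_topologicalClosure_eq_top, eq_top_iff, ← e.dense_span]
  refine Submodule.topologicalClosure_mono (Submodule.span_le.2 ?_)
  rintro _ ⟨i, rfl⟩
  exact D.mem_domain_of_mem_graph (h.basis_mem i)

theorem symmetric (h : IsDiagonal e lam D) : D.IsFormalAdjoint D := by
  intro v w
  refine (e.hasSum_inner_mul_inner (D v) (w : H)).unique ?_
  convert e.hasSum_inner_mul_inner (v : H) (D w) using 2 with i
  rw [h.inner_apply, ← inner_conj_symm (D v), h.inner_apply, map_mul, inner_conj_symm,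
    Complex.conj_ofReal]
  ring

theorem isClosable (h : IsDiagonal e lam D) : D.IsClosable := by
  have hg : ∀ x ∈ diagGraph e lam, x.1 = 0 → x.2 = 0 := by
    rintro ⟨v, w⟩ hvw h0
    simp only at h0
    subst h0
    exact ext_inner_basis e fun i => by simpa using mem_diagGraph.1 hvw i
  refine ⟨(diagGraph e lam).toLinearPMap, ?_⟩
  rw [Submodule.toLinearPMap_graph_eq _ hg]
  exact le_antisymm (Submodule.topologicalClosure_minimal _ h.graph_le (isClosed_diagGraph e lam))
    (diagGraph_le_closure e lam h.basis_mem)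

theorem graph_closure (h : IsDiagonal e lam D) : D.closure.graph = diagGraph e lam := by
  rw [← h.isClosable.graph_closure_eq_closure_graph]
  exact le_antisymm (Submodule.topologicalClosure_minimal _ h.graph_le (isClosed_diagGraph e lam))
    (diagGraph_le_closure e lam h.basis_mem)

theorem closure (h : IsDiagonal e lam D) : IsDiagonal e lam D.closure :=
  ⟨fun i => h.graph_closure ▸ basis_mem_diagGraph e lam i, h.graph_closure.le⟩

/-- Testing a vector of the domain of the adjoint against the eigenvectors shows that it belongs
to the maximal domain. -/
theorem isSelfAdjoint_closure [CompleteSpace H] (h : IsDiagonal e lam D) :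
    IsSelfAdjoint D.closure := by
  rw [LinearPMap.isSelfAdjoint_def]
  have hd := h.closure.dense_domain
  refine LinearPMap.eq_of_eq_graph (le_antisymm ?_ ?_)
  · intro x hx
    rw [h.graph_closure]
    intro i
    obtain ⟨y, hy1, hy2⟩ := (LinearPMap.mem_graph_iff _).1 hx
    obtain ⟨u, hu1, hu2⟩ := (LinearPMap.mem_graph_iff _).1 (h.closure.basis_mem i)
    have := LinearPMap.adjoint_isFormalAdjoint hd y u
    simp only at hu1 hu2
    rw [← hy2, ← hy1, ← hu1, ← inner_conj_symm, this, hu2, inner_smul_right, hu1, map_mul,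
      inner_conj_symm, Complex.conj_ofReal]
  · exact LinearPMap.le_graph_of_le (LinearPMap.IsFormalAdjoint.le_adjoint hd h.closure.symmetric)

theorem isEssentiallySelfAdjoint [CompleteSpace H] (h : IsDiagonal e lam D) :
    IsEssentiallySelfAdjoint D :=
  ⟨h.dense_domain, h.symmetric, h.isClosable, h.isSelfAdjoint_closure⟩

/-- If the matrix of the bounded operator `C` is that of the commutator `[D, T]`, then `T`
preserves the domain of the closed operator `D`, and `[D, T]` is the restriction of `C`. -/
theorem commutator (h : IsDiagonal e lam D) {T C : H →L[ℂ] H}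
    (hC : ∀ i j, ⟪e i, C (e j)⟫_ℂ = (lam i - lam j) * ⟪e i, T (e j)⟫_ℂ)
    (v : D.closure.domain) : (T v, C v + T (D.closure v)) ∈ D.closure.graph := by
  rw [h.graph_closure, mem_diagGraph]
  intro i
  rw [inner_add_right]
  refine ((hasSum_inner_map e C (e i) v).add (hasSum_inner_map e T (e i) (D.closure v))).unique ?_
  refine ((hasSum_inner_map e T (e i) v).mul_left (lam i : ℂ)).congr_fun fun j => ?_
  rw [hC, h.closure.inner_apply]
  ring

end IsDiagonal

end Diagonal

/-! ### Compact resolvent and spectral dimension of diagonal operators -/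

section Spectral

variable {H : Type*} [NormedAddCommGroup H] [InnerProductSpace ℂ H] {ι : Type*}

theorem hasSum_norm_sq_inner_basis (e : HilbertBasis ι ℂ H) (v : H) :
    HasSum (fun i => ‖⟪e i, v⟫_ℂ‖ ^ 2) (‖v‖ ^ 2) := by
  have h := e.hasSum_inner_mul_inner v v
  have h2 := Complex.hasSum_re h
  convert h2 using 1
  · ext i
    rw [← inner_conj_symm v, ← Complex.normSq_eq_conj_mul_self, Complex.ofReal_re,
      Complex.normSq_eq_norm_sq]
  · rw [inner_self_eq_norm_sq_to_K, ← Complex.ofReal_re (‖v‖ ^ 2)]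
    norm_cast

theorem norm_le_of_inner_basis_le (e : HilbertBasis ι ℂ H) {v w : H} {C : ℝ} (hC : 0 ≤ C)
    (h : ∀ i, ‖⟪e i, w⟫_ℂ‖ ≤ C * ‖⟪e i, v⟫_ℂ‖) : ‖w‖ ≤ C * ‖v‖ := by
  refine le_of_sq_le_sq ?_ (by positivity)
  rw [mul_pow]
  refine hasSum_le (fun i => ?_) (hasSum_norm_sq_inner_basis e w)
    ((hasSum_norm_sq_inner_basis e v).mul_left (C ^ 2))
  rw [← mul_pow]
  exact pow_le_pow_left₀ (norm_nonneg _) (h i) 2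

theorem inner_basis_diagonal (e : HilbertBasis ι ℂ H) {R : H →L[ℂ] H}
    {ρ : ι → ℂ} (hR : ∀ i, R (e i) = ρ i • e i) (i : ι) (v : H) :
    ⟪e i, R v⟫_ℂ = ρ i * ⟪e i, v⟫_ℂ := by
  refine (hasSum_inner_map e R (e i) v).unique ?_
  convert hasSum_single i fun j hj => ?_ using 1
  · rw [hR, inner_smul_right, inner_basis_self]; ring
  · rw [hR, inner_smul_right, inner_basis_ne e (Ne.symm hj)]; ring

/-- A bounded operator with an orthonormal basis of eigenvectors whose eigenvalues tend to `0` is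
the norm limit of its finite-rank restrictions. -/
theorem isCompactOperator_of_diagonal [CompleteSpace H] (e : HilbertBasis ι ℂ H) {R : H →L[ℂ] H}
    {ρ : ι → ℂ} (hR : ∀ i, R (e i) = ρ i • e i) (hρ : Filter.Tendsto ρ Filter.cofinite (nhds 0)) :
    IsCompactOperator R := by
  classical
  let K : Finset ι → (H →L[ℂ] H) := fun s => ∑ i ∈ s, ρ i • (innerSL ℂ (e i)).smulRight (e i)
  have hK1 : ∀ s v, K s v = ∑ i ∈ s, ρ i • ⟪e i, v⟫_ℂ • e i := fun s v => by simp [K]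
  have hK : ∀ s, IsCompactOperator (K s) := by
    intro s
    refine Submodule.sum_mem (compactOperator (RingHom.id ℂ) H H) fun i _ =>
      Submodule.smul_mem _ _ ?_
    exact (isCompactOperator_of_locallyCompactSpace_dom (innerSL ℂ (e i))).clm_comp
      (ContinuousLinearMap.toSpanSingleton ℂ (e i))
  refine isCompactOperator_of_tendsto (l := Filter.atTop) (F := K) ?_ (.of_forall hK)
  rw [Metric.tendsto_atTop]
  intro ε hε
  have hfin : {i | ¬ ‖ρ i‖ < ε / 2}.Finite := by
    have h0 : ‖(0 : ℂ)‖ < ε / 2 := by rw [norm_zero]; positivity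
    exact hρ.norm.eventually_lt_const h0
  refine ⟨hfin.toFinset, fun s hs => ?_⟩
  rw [dist_eq_norm, norm_sub_rev]
  refine lt_of_le_of_lt (ContinuousLinearMap.opNorm_le_bound _ (by positivity : 0 ≤ ε / 2)
    fun v => norm_le_of_inner_basis_le e (by positivity) fun i => ?_) (half_lt_self hε)
  rw [sub_apply, inner_sub_right, inner_basis_diagonal e hR, hK1, inner_sum]
  simp only [inner_smul_right]
  by_cases hi : i ∈ s
  · rw [Finset.sum_eq_single i (fun j _ hj => by rw [inner_basis_ne e (Ne.symm hj)]; ring)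
      (fun h => absurd hi h), inner_basis_self, mul_one, sub_self, norm_zero]
    positivity
  · rw [Finset.sum_eq_zero fun j hj => by
      rw [inner_basis_ne e (by rintro rfl; exact hi hj), mul_zero, mul_zero], sub_zero, norm_mul]
    have : ‖ρ i‖ < ε / 2 := by
      by_contra h
      exact hi (hs (hfin.mem_toFinset.2 h))
    gcongr

/-- The functional calculus of `B` acts on an eigenvector of `B` through the eigenvalue. -/
theorem cfc_apply_eigenvector [CompleteSpace H] {B : H →L[ℂ] H} (hB : IsSelfAdjoint B)
    {f : ℝ → ℝ} (hf : Continuous f) {v : H} {x : ℝ} (hv0 : v ≠ 0) (hv : B v = (x : ℂ) • v) :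
    cfc f B v = (f x : ℂ) • v := by
  have hx : x ∈ spectrum ℝ B := by
    rintro ⟨U, hU⟩
    have h0 : (U : H →L[ℂ] H) v = 0 := by
      rw [hU, sub_apply, hv, Algebra.algebraMap_eq_smul_one]
      simp
    apply hv0
    have h1 : ((↑U⁻¹ : H →L[ℂ] H) * (U : H →L[ℂ] H)) v = v := by rw [Units.inv_mul]; rfl
    have h2 : ((↑U⁻¹ : H →L[ℂ] H) * (U : H →L[ℂ] H)) v = (↑U⁻¹ : H →L[ℂ] H) ((U : H →L[ℂ] H) v) :=
      rfl
    rw [← h1, h2, h0, map_zero]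
  rw [cfc_apply f B hB]
  let x' : spectrum ℝ B := ⟨x, hx⟩
  -- The functions of `B` which act on `v` as expected form a closed algebra containing `B`.
  suffices h : ∀ g : C(spectrum ℝ B, ℝ), cfcHom hB g v = (g x' : ℂ) • v from h _
  have hid : cfcHom hB (.restrict (spectrum ℝ B) <| .id ℝ) v = (x : ℂ) • v := by
    rw [cfcHom_id, hv]
  intro g
  refine ContinuousMap.induction_on_of_compact (𝕜 := ℝ)
    (p := fun g => cfcHom hB g v = (g x' : ℂ) • v) ?_ hid ?_ ?_ ?_ ?_ g
  · intro r
    have : ContinuousMap.const (spectrum ℝ B) r = algebraMap ℝ C(spectrum ℝ B, ℝ) r := rfl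
    rw [this, AlgHomClass.commutes, Algebra.algebraMap_eq_smul_one]
    simp
  · rw [map_star, cfcHom_id, hB.star_eq, hv]
    rfl
  · intro g₁ g₂ h₁ h₂
    rw [map_add, add_apply, h₁, h₂, ← add_smul]
    simp
  · intro g₁ g₂ h₁ h₂
    rw [map_mul]
    change cfcHom hB g₁ (cfcHom hB g₂ v) = _
    rw [h₂, map_smul, h₁, smul_smul, mul_comm]
    simp
  · intro g hg
    have hc : IsClosed {g : C(spectrum ℝ B, ℝ) | cfcHom hB g v = (g x' : ℂ) • v} := by
      have h1 : Continuous fun g : C(spectrum ℝ B, ℝ) => cfcHom hB g v :=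
        (ContinuousLinearMap.apply ℂ H v).continuous.comp (cfcHom_continuous hB)
      have h2 : Continuous fun g : C(spectrum ℝ B, ℝ) => (g x' : ℂ) • v :=
        (Complex.continuous_ofReal.comp (continuous_eval_const x')).smul
          continuous_const
      exact isClosed_eq h1 h2
    exact hc.mem_of_frequently_of_tendsto hg Filter.tendsto_id

/-- The trace of a positive diagonal operator is the sum of its eigenvalues: over any orthonormal
set it is at most that, by Bessel's inequality for the vectors of the basis. -/
theorem posTrace_diagonal (e : HilbertBasis ι ℂ H) {T : H →L[ℂ] H} {t : ι → ℝ}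
    (ht : ∀ i, 0 ≤ t i) (hT : ∀ i, T (e i) = (t i : ℂ) • e i) :
    posTrace T = ∑' i, ENNReal.ofReal (t i) := by
  refine le_antisymm (iSup₂_le fun S hS => ?_) ?_
  · have h1 : ∀ v : H, ENNReal.ofReal (⟪v, T v⟫_ℂ).re =
        ∑' i, ENNReal.ofReal (t i * ‖⟪v, e i⟫_ℂ‖ ^ 2) := by
      intro v
      have h := Complex.hasSum_re (hasSum_inner_map e T v v)
      have h' : HasSum (fun i => t i * ‖⟪v, e i⟫_ℂ‖ ^ 2) (⟪v, T v⟫_ℂ).re := by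
        convert h using 1
        ext i
        rw [hT, inner_smul_right, mul_left_comm, ← inner_conj_symm (e i) v,
          ← Complex.normSq_eq_conj_mul_self, Complex.normSq_eq_norm_sq]
        norm_cast
      rw [← h'.tsum_eq, ENNReal.ofReal_tsum_of_nonneg (fun i => mul_nonneg (ht i) (sq_nonneg _))
        h'.summable]
    simp only [h1]
    rw [ENNReal.tsum_comm]
    refine ENNReal.tsum_le_tsum fun i => ?_
    simp only [ENNReal.ofReal_mul (ht i)]
    rw [ENNReal.tsum_mul_left]
    refine mul_le_of_le_one_right' ?_
    rw [← ENNReal.ofReal_tsum_of_nonneg (fun _ => sq_nonneg _) (hS.inner_products_summable (e i))]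
    refine ENNReal.ofReal_le_one.2 ((hS.tsum_inner_products_le (e i)).trans ?_)
    rw [e.orthonormal.1 i, one_pow]
  · have hinj : Function.Injective e := e.orthonormal.linearIndependent.injective
    refine le_iSup₂_of_le (range e) e.orthonormal.toSubtypeRange ?_
    rw [← (Equiv.ofInjective e hinj).tsum_eq]
    refine (ENNReal.tsum_le_tsum fun i => ?_)
    change _ ≤ ENNReal.ofReal (⟪e i, T (e i)⟫_ℂ).re
    rw [hT, inner_smul_right, inner_basis_self, mul_one, Complex.ofReal_re]

/-- For a uniformly bounded family the convention `0` in `directSum` does not apply. -/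
theorem directSum_apply {H : ι → Type*} [∀ i, NormedAddCommGroup (H i)]
    [∀ i, InnerProductSpace ℂ (H i)] (T : ∀ i, H i →L[ℂ] H i) {C : ℝ} (hC0 : 0 ≤ C)
    (hC : ∀ i, ‖T i‖ ≤ C) (v : lp H 2) (i : ι) : directSum T v i = T i (v i) := by
  have h : ∃ C : ℝ, 0 ≤ C ∧ ∀ i, ‖T i‖ ≤ C := ⟨C, hC0, hC⟩
  rw [directSum, dif_pos h]
  rfl

/-- A bounded sequence of eigenvalues defines a bounded diagonal operator. -/
theorem exists_diagonal (e : HilbertBasis ι ℂ H) {ρ : ι → ℂ} {C : ℝ} (hC0 : 0 ≤ C)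
    (hC : ∀ i, ‖ρ i‖ ≤ C) : ∃ B : H →L[ℂ] H, ∀ i, B (e i) = ρ i • e i := by
  classical
  let T : ι → ℂ →L[ℂ] ℂ := fun i => ρ i • ContinuousLinearMap.id ℂ ℂ
  have hT : ∀ i, ‖T i‖ ≤ C := fun i => by
    rw [norm_smul, ContinuousLinearMap.norm_id, mul_one]
    exact hC i
  refine ⟨(e.repr.symm.toContinuousLinearEquiv : _ →L[ℂ] H) ∘L directSum T ∘L
    (e.repr.toContinuousLinearEquiv : H →L[ℂ] _), fun i => ?_⟩
  refine e.repr.injective (lp.ext (funext fun j => ?_))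
  simp only [ContinuousLinearMap.comp_apply, ContinuousLinearEquiv.coe_coe,
    LinearIsometryEquiv.coe_toContinuousLinearEquiv, LinearIsometryEquiv.apply_symm_apply, map_smul]
  rw [directSum_apply T hC0 hT]
  change ρ j * e.repr (e i) j = ρ i * e.repr (e i) j
  rw [e.repr_apply_apply]
  by_cases h : j = i
  · rw [h]
  · rw [inner_basis_ne e h, mul_zero, mul_zero]

theorem isSelfAdjoint_of_diagonal [CompleteSpace H] (e : HilbertBasis ι ℂ H) {B : H →L[ℂ] H}
    {ρ : ι → ℝ} (hB : ∀ i, B (e i) = (ρ i : ℂ) • e i) : IsSelfAdjoint B := by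
  refine ext_matrix e fun i j => ?_
  rw [ContinuousLinearMap.star_eq_adjoint, ContinuousLinearMap.adjoint_inner_right, hB, hB,
    inner_smul_left, inner_smul_right, Complex.conj_ofReal]
  by_cases h : i = j
  · rw [h]
  · rw [inner_basis_ne e h, mul_zero, mul_zero]

namespace IsDiagonal

variable {e : HilbertBasis ι ℂ H} {lam : ι → ℝ} {D : H →ₗ.[ℂ] H}

theorem isResolventAt_zero (h : IsDiagonal e lam D) (hlam : ∀ i, lam i ≠ 0) {B : H →L[ℂ] H}
    (hB : ∀ i, B (e i) = ((lam i)⁻¹ : ℂ) • e i) : IsResolventAt D.closure 0 B := by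
  have hne : ∀ i, (lam i : ℂ) ≠ 0 := fun i => Complex.ofReal_ne_zero.2 (hlam i)
  refine ⟨fun v => ?_, fun v => ?_⟩
  · have hv : (B v, v) ∈ D.closure.graph := by
      rw [h.graph_closure, mem_diagGraph]
      intro i
      rw [inner_basis_diagonal e hB, mul_inv_cancel_left₀ (hne i)]
    obtain ⟨u, hu1, hu2⟩ := (LinearPMap.mem_graph_iff _).1 hv
    refine ⟨LinearPMap.mem_domain_of_mem_graph hv, ?_⟩
    rw [zero_smul, sub_zero]
    exact (congrArg D.closure (Subtype.ext hu1.symm)).trans hu2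
  · refine ext_inner_basis e fun i => ?_
    rw [inner_basis_diagonal e hB, zero_smul, sub_zero, h.closure.inner_apply,
      inv_mul_cancel_left₀ (hne i)]

theorem hasCompactResolvent [CompleteSpace H] (h : IsDiagonal e lam D) (hpos : ∀ i, 0 < lam i)
    (hlam : Filter.Tendsto lam Filter.cofinite Filter.atTop)
    {B : H →L[ℂ] H} (hB : ∀ i, B (e i) = ((lam i)⁻¹ : ℂ) • e i) :
    HasCompactResolvent D.closure := by
  refine ⟨⟨0, B, h.isResolventAt_zero (fun i => (hpos i).ne') hB⟩, fun μ R hR => ?_⟩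
  -- The resolvent at `μ` is diagonal, with eigenvalues `(lam i - μ)⁻¹`.
  have hR1 : ∀ i, ((lam i : ℂ) - μ) • R (e i) = e i := fun i => by
    obtain ⟨u, hu1, hu2⟩ := (LinearPMap.mem_graph_iff _).1 (h.closure.basis_mem i)
    have := hR.2 u
    simp only at hu1 hu2
    rwa [hu2, hu1, ← sub_smul, map_smul] at this
  have hR2 : ∀ i, R (e i) = ((lam i : ℂ) - μ)⁻¹ • e i := fun i => by
    have h0 : (lam i : ℂ) - μ ≠ 0 := by
      intro h0
      have := hR1 i
      rw [h0, zero_smul] at this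
      exact e.orthonormal.ne_zero i this.symm
    conv_rhs => rw [← hR1 i, inv_smul_smul₀ h0]
  refine isCompactOperator_of_diagonal e hR2 (Filter.tendsto_inv₀_cobounded.comp ?_)
  rw [← tendsto_norm_atTop_iff_cobounded]
  refine Filter.tendsto_atTop_mono (fun i => ?_)
    (Filter.tendsto_atTop_add_const_right _ (-‖μ‖) hlam)
  have := norm_sub_norm_le (lam i : ℂ) μ
  rw [Complex.norm_real, Real.norm_of_nonneg (hpos i).le] at this
  linarith

theorem hasSpectralDimension [CompleteSpace H] (h : IsDiagonal e lam D) (hpos : ∀ i, 0 < lam i)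
    {B : H →L[ℂ] H} (hB : ∀ i, B (e i) = ((lam i)⁻¹ : ℂ) • e i) {d : ℝ} (hd0 : 0 ≤ d)
    (hd : ∀ s, 0 < s → (∑' i, ENNReal.ofReal ((lam i)⁻¹ ^ s) < ⊤ ↔ d < s)) :
    HasSpectralDimension D.closure d := by
  refine ⟨B, h.isResolventAt_zero (fun i => (hpos i).ne') hB, ?_⟩
  have hB' : ∀ i, B (e i) = (((lam i)⁻¹ : ℝ) : ℂ) • e i := fun i => by
    rw [hB, Complex.ofReal_inv]
  have hset : {s : ℝ | 0 < s ∧ posTrace (cfc (fun x : ℝ => |x| ^ s) B) < ⊤} = Ioi d := by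
    ext s
    have key : 0 < s → posTrace (cfc (fun x : ℝ => |x| ^ s) B) =
        ∑' i, ENNReal.ofReal ((lam i)⁻¹ ^ s) := fun hs => by
      refine posTrace_diagonal e (fun i => Real.rpow_nonneg (inv_nonneg.2 (hpos i).le) _)
        fun i => ?_
      have hc : Continuous fun x : ℝ => |x| ^ s :=
        continuous_abs.rpow_const fun _ => Or.inr hs.le
      have := cfc_apply_eigenvector (isSelfAdjoint_of_diagonal e hB') hc
        (e.orthonormal.ne_zero i) (hB' i)
      rw [abs_of_pos (inv_pos.2 (hpos i))] at this
      exact this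
    refine ⟨fun hs => ?_, fun hs => ?_⟩
    · have := hs.2
      rw [key hs.1] at this
      exact (hd s hs.1).1 this
    · have hs0 : 0 < s := hd0.trans_lt hs
      refine ⟨hs0, ?_⟩
      rw [key hs0]
      exact (hd s hs0).2 hs
  rw [hset]
  exact isGLB_Ioi

end IsDiagonal

end Spectral

/-! ### The monomial basis of the Hardy space and the operator `z ∂_z` -/

section Hardy

theorem integral_circleMeasure (r : ℝ) {g : ℂ → ℂ}
    (hg : AEStronglyMeasurable g (circleMeasure r)) :
    ∫ z, g z ∂circleMeasure r =
      (2 * Real.pi : ℂ)⁻¹ * ∫ t in (0 : ℝ)..2 * Real.pi, g (circleMap 0 r t) := by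
  have h0 : (0 : ℝ) < (2 * Real.pi)⁻¹ := by positivity
  have hg' : AEStronglyMeasurable g ((volume.restrict (Ioc 0 (2 * Real.pi))).map (circleMap 0 r)) :=
    hg.mono_ac (Measure.absolutelyContinuous_smul (ENNReal.ofReal_pos.2 h0).ne')
  rw [circleMeasure, integral_smul_measure,
    integral_map (continuous_circleMap 0 r).aemeasurable hg',
    intervalIntegral.integral_of_le Real.two_pi_pos.le, ENNReal.toReal_ofReal h0.le,
    Complex.real_smul]
  push_cast
  rfl

theorem integral_exp_int_mul (n : ℤ) :
    ∫ t in (0 : ℝ)..2 * Real.pi, Complex.exp (Complex.I * n * t) =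
      if n = 0 then 2 * (Real.pi : ℂ) else 0 := by
  split_ifs with h
  · simp [h]
  · have hc : Complex.I * n ≠ 0 := mul_ne_zero Complex.I_ne_zero (Int.cast_ne_zero.2 h)
    rw [integral_exp_mul_complex hc]
    have : Complex.exp (Complex.I * n * ((2 * Real.pi : ℝ) : ℂ)) = 1 := by
      rw [Complex.exp_eq_one_iff]
      exact ⟨n, by push_cast; ring⟩
    rw [this]
    simp

theorem HasSum.of_eq {ι : Type*} {f g : ι → ℂ} {a b : ℂ} (h : HasSum f a) (hf : ∀ i, g i = f i)
    (hb : b = a) : HasSum g b := by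
  rw [hb, funext hf]
  exact h

variable {r : ℝ}

theorem circleMap_div (hr : 0 < r) (t : ℝ) :
    circleMap 0 r t / r = Complex.exp (Complex.I * t) := by
  have : (r : ℂ) ≠ 0 := Complex.ofReal_ne_zero.2 hr.ne'
  rw [circleMap, zero_add, mul_div_cancel_left₀ _ this, mul_comm]

/-- On the circle, `conj (z/r)^j (z/r)^k = e^{i(k-j)t}`. -/
theorem conj_pow_mul_pow (hr : 0 < r) (j k : ℕ) (t : ℝ) :
    (starRingEnd ℂ) ((circleMap 0 r t / r) ^ j) * (circleMap 0 r t / r) ^ k =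
      Complex.exp (Complex.I * ((k : ℤ) - (j : ℤ) : ℤ) * t) := by
  rw [circleMap_div hr, map_pow, ← Complex.exp_conj, ← Complex.exp_nat_mul, ← Complex.exp_nat_mul,
    ← Complex.exp_add, map_mul, Complex.conj_I, Complex.conj_ofReal]
  congr 1
  push_cast
  ring

theorem pow_mem_hardySpace (r : ℝ) (k : ℕ) : (memLp_pow r k).toLp ∈ HardySpace r :=
  Submodule.le_topologicalClosure _ (Submodule.subset_span ⟨k, rfl⟩)

/-- The normalized monomial `(z / r) ^ k`, an element of the Hardy space. -/
def hardyMonomial (r : ℝ) (k : ℕ) : HardySpace r :=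
  ((r : ℂ) ^ k)⁻¹ • ⟨(memLp_pow r k).toLp, pow_mem_hardySpace r k⟩

theorem hardyMonomial_ae (r : ℝ) (k : ℕ) :
    (hardyMonomial r k).1 =ᵐ[circleMeasure r] fun z => (z / r) ^ k := by
  rw [hardyMonomial, Submodule.coe_smul]
  filter_upwards [Lp.coeFn_smul ((r : ℂ) ^ k)⁻¹ ((memLp_pow r k).toLp), (memLp_pow r k).coeFn_toLp]
    with z h1 h2
  rw [h1, Pi.smul_apply, h2, smul_eq_mul, div_pow, div_eq_inv_mul]

theorem inner_hardyMonomial_left (k : ℕ) (φ : HardySpace r) :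
    ⟪hardyMonomial r k, φ⟫_ℂ = ∫ z, (starRingEnd ℂ) ((z / r) ^ k) * φ.1 z ∂circleMeasure r := by
  rw [Submodule.coe_inner, L2.inner_def]
  refine integral_congr_ae ?_
  filter_upwards [hardyMonomial_ae r k] with z h
  rw [h, RCLike.inner_apply, mul_comm]

theorem orthonormal_hardyMonomial (hr : 0 < r) : Orthonormal ℂ (hardyMonomial r) := by
  rw [orthonormal_iff_ite]
  intro j k
  have h1 : ⟪hardyMonomial r j, hardyMonomial r k⟫_ℂ =
      ∫ z, (starRingEnd ℂ) ((z / r) ^ j) * (z / r) ^ k ∂circleMeasure r := by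
    rw [inner_hardyMonomial_left]
    refine integral_congr_ae ?_
    filter_upwards [hardyMonomial_ae r k] with z h
    rw [h]
  have hm : Measurable fun z : ℂ => (starRingEnd ℂ) ((z / r) ^ j) * (z / r) ^ k :=
    (Complex.continuous_conj.measurable.comp (by fun_prop)).mul (by fun_prop)
  rw [h1, integral_circleMeasure r hm.aestronglyMeasurable]
  simp only [conj_pow_mul_pow hr]
  rw [integral_exp_int_mul]
  have h2 : ((k : ℤ) - (j : ℤ) = 0) ↔ j = k := by omega
  simp only [h2]
  split_ifs
  · exact inv_mul_cancel₀ (mul_ne_zero two_ne_zero (Complex.ofReal_ne_zero.2 Real.pi_ne_zero))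
  · exact mul_zero _

/-- The orthonormal basis of the Hardy space formed by the normalized monomials. -/
def hardyBasis (hr : 0 < r) : HilbertBasis ℕ ℂ (HardySpace r) :=
  HilbertBasis.mkOfOrthogonalEqBot (orthonormal_hardyMonomial hr) <| by
    rw [eq_bot_iff]
    intro φ hφ
    have h1 : ∀ k, ⟪(memLp_pow r k).toLp, φ.1⟫_ℂ = 0 := fun k => by
      have := Submodule.mem_orthogonal _ _ |>.1 hφ (hardyMonomial r k)
        (Submodule.subset_span ⟨k, rfl⟩)
      rw [hardyMonomial, inner_smul_left (⟨_, pow_mem_hardySpace r k⟩ : HardySpace r) φ _,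
        Submodule.coe_inner] at this
      refine (mul_eq_zero.1 this).resolve_left ?_
      simp [hr.ne']
    have h2 : φ.1 ∈ (HardySpace r)ᗮ := by
      change φ.1 ∈ (Submodule.topologicalClosure _)ᗮ
      rw [Submodule.orthogonal_closure, Submodule.mem_orthogonal]
      intro u hu
      induction hu using Submodule.span_induction with
      | mem x hx => obtain ⟨k, rfl⟩ := hx; exact h1 k
      | zero => exact inner_zero_left _
      | add x y _ _ hx hy => rw [inner_add_left, hx, hy, add_zero]
      | smul a x _ hx => rw [inner_smul_left, hx, mul_zero]
    have h3 : ⟪φ.1, φ.1⟫_ℂ = 0 := (Submodule.mem_orthogonal _ _).1 h2 _ φ.2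
    exact (Submodule.mem_bot ℂ).2 (Subtype.ext (inner_self_eq_zero.1 h3))

theorem hardyBasis_apply (hr : 0 < r) (k : ℕ) : hardyBasis hr k = hardyMonomial r k := by
  rw [hardyBasis, HilbertBasis.coe_mkOfOrthogonalEqBot]

theorem norm_conj_pow_eq (hr : 0 < r) (k : ℕ) {ζ : ℂ} (hζ : ‖ζ‖ = r) :
    ‖(starRingEnd ℂ) ((ζ / r) ^ k)‖ = 1 := by
  rw [RCLike.norm_conj, norm_pow, norm_div, hζ, Complex.norm_real, Real.norm_of_nonneg hr.le,
    div_self hr.ne', one_pow]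

/-- The holomorphic extension has the coordinates of `φ` as Taylor coefficients: expand the Cauchy
kernel into a geometric series. -/
theorem hasSum_holoExt (hr : 0 < r) (φ : HardySpace r) {z : ℂ} (hz : z ∈ Metric.ball (0 : ℂ) r) :
    HasSum (fun k => ⟪hardyMonomial r k, φ⟫_ℂ * (z / r) ^ k) (holoExt φ z) := by
  have hz' : ‖z‖ < r := by simpa using hz
  have hae := ae_norm_eq r
  rw [abs_of_pos hr] at hae
  have hint : Integrable (fun ζ => φ.1 ζ) (circleMeasure r) := (Lp.memLp φ.1).integrable one_le_two
  let F : ℕ → ℂ → ℂ := fun k ζ => (z / r) ^ k * ((starRingEnd ℂ) ((ζ / r) ^ k) * φ.1 ζ)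
  have hm : ∀ k, Measurable fun ζ : ℂ => (starRingEnd ℂ) ((ζ / r) ^ k) := fun k =>
    Complex.continuous_conj.measurable.comp (by fun_prop)
  have hF : ∀ k, Integrable (F k) (circleMeasure r) := fun k =>
    (hint.bdd_mul (c := 1) (hm k).aestronglyMeasurable
      (hae.mono fun ζ h => (norm_conj_pow_eq hr k h).le)).const_mul _
  have hq : ‖z / r‖ < 1 := by
    rw [norm_div, Complex.norm_real, Real.norm_of_nonneg hr.le, div_lt_one hr]
    exact hz'
  have hnorm : ∀ k, ∫ ζ, ‖F k ζ‖ ∂circleMeasure r =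
      ‖z / r‖ ^ k * ∫ ζ, ‖φ.1 ζ‖ ∂circleMeasure r := fun k => by
    rw [← integral_const_mul]
    refine integral_congr_ae (hae.mono fun ζ h => ?_)
    simp only [F]
    rw [norm_mul, norm_mul, norm_conj_pow_eq hr k h, one_mul, norm_pow]
  have hsum : Summable fun k => ∫ ζ, ‖F k ζ‖ ∂circleMeasure r := by
    simp only [hnorm]
    exact (summable_geometric_of_lt_one (norm_nonneg _) hq).mul_right _
  have h := hasSum_integral_of_summable_integral_norm hF hsum
  refine HasSum.of_eq h (fun k => ?_) ?_
  · rw [integral_const_mul, inner_hardyMonomial_left, mul_comm]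
  · rw [holoExt]
    refine integral_congr_ae (hae.mono fun ζ h => ?_)
    have hζ0 : ζ ≠ 0 := by
      rintro rfl
      rw [norm_zero] at h
      exact hr.ne h
    have hr0 : (r : ℂ) ≠ 0 := Complex.ofReal_ne_zero.2 hr.ne'
    have hconj : (starRingEnd ℂ) (ζ / r) = r / ζ := by
      rw [map_div₀, Complex.conj_ofReal, div_eq_div_iff hr0 hζ0, mul_comm, Complex.mul_conj,
        Complex.normSq_eq_norm_sq, h]
      push_cast
      ring
    have hterm : ∀ k, F k ζ = (z / ζ) ^ k * φ.1 ζ := fun k => by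
      simp only [F]
      rw [map_pow, hconj, ← mul_assoc, ← mul_pow, div_mul_div_cancel₀ hr0]
    have hgeom : ‖z / ζ‖ < 1 := by
      rw [norm_div, h, div_lt_one hr]
      exact hz'
    simp only [hterm]
    rw [tsum_mul_right, tsum_geometric_of_norm_lt_one hgeom, mul_comm, one_sub_div hζ0, inv_div]

theorem holoExt_hardyMonomial (hr : 0 < r) (k : ℕ) {z : ℂ} (hz : z ∈ Metric.ball (0 : ℂ) r) :
    holoExt (hardyMonomial r k) z = (z / r) ^ k := by
  refine (hasSum_holoExt hr _ hz).unique ?_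
  refine HasSum.of_eq (hasSum_single k fun j hj => ?_) (fun _ => rfl) ?_
  rotate_left
  · rw [inner_self_eq_norm_sq_to_K (hardyMonomial r k), (orthonormal_hardyMonomial hr).1 k]; simp
  · rw [(orthonormal_hardyMonomial hr).2 hj, zero_mul]

theorem hardyMonomial_mem_radialGraph (hr : 0 < r) (k : ℕ) :
    (hardyMonomial r k, (k : ℂ) • hardyMonomial r k) ∈ radialGraph r := by
  intro z hz
  refine ⟨k * (z / r) ^ (k - 1) * (1 / r), ?_, ?_⟩
  · have h : HasDerivAt (fun z : ℂ => (z / r) ^ k) (k * (z / r) ^ (k - 1) * (1 / r)) z :=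
      ((hasDerivAt_id z).div_const (r : ℂ)).pow k
    refine h.congr_of_eventuallyEq ?_
    filter_upwards [Metric.isOpen_ball.mem_nhds hz] with w hw
    exact holoExt_hardyMonomial hr k hw
  · rw [holoExt_smul, holoExt_hardyMonomial hr k hz]
    cases k with
    | zero => simp
    | succ k => rw [Nat.add_sub_cancel, pow_succ]; ring

/-- Coefficient comparison in `g = z f'` for power series `f`, `g`. -/
theorem coeff_eq_of_eq_mul_deriv {r : ℝ} (hr : 0 < r) {f g : ℂ → ℂ} {a b : ℕ → ℂ}
    (hf : ∀ z ∈ Metric.ball (0 : ℂ) r, HasSum (fun k => z ^ k * a k) (f z))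
    (hg : ∀ z ∈ Metric.ball (0 : ℂ) r, HasSum (fun k => z ^ k * b k) (g z))
    (hfg : ∀ z ∈ Metric.ball (0 : ℂ) r, ∃ w, HasDerivAt f w z ∧ g z = z * w) (k : ℕ) :
    b k = k * a k := by
  have hball := Metric.ball_mem_nhds (0 : ℂ) hr
  have hps : ∀ {h : ℂ → ℂ} {c : ℕ → ℂ}, (∀ᶠ z in nhds (0 : ℂ), HasSum (fun k => z ^ k * c k) (h z)) →
      HasFPowerSeriesAt h (FormalMultilinearSeries.ofScalars ℂ c) 0 := by
    intro h c hh
    rw [hasFPowerSeriesAt_iff]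
    filter_upwards [hh] with z hz
    simpa [FormalMultilinearSeries.coeff_ofScalars] using hz
  have hfp := hps (Filter.eventually_of_mem hball hf)
  have hgp := hps (Filter.eventually_of_mem hball hg)
  obtain ⟨ρ, hρ⟩ := hfp
  have hd := hρ.fderiv
  -- The series of `f'` evaluated at `1`, multiplied by `z`, is a second power series of `g`.
  have hg' : ∀ᶠ z in nhds (0 : ℂ), HasSum (fun k : ℕ => z ^ k * (k * a k)) (g z) := by
    filter_upwards [hball, hd.eventually_hasSum] with z hz hs
    obtain ⟨w, hw, hgw⟩ := hfg z hz
    rw [zero_add] at hs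
    have h1 := hs.mapL (ContinuousLinearMap.apply ℂ ℂ (1 : ℂ))
    have h2 : HasSum (fun n : ℕ => z ^ n * ((n + 1 : ℕ) * a (n + 1))) w := by
      refine HasSum.of_eq h1 (fun n => ?_) ?_
      · have h4 : ((FormalMultilinearSeries.ofScalars ℂ a).derivSeries n fun _ => z) =
            z ^ n • (FormalMultilinearSeries.ofScalars ℂ a).derivSeries.coeff n :=
          FormalMultilinearSeries.apply_eq_pow_smul_coeff
        rw [h4, ContinuousLinearMap.apply_apply, smul_apply,
          FormalMultilinearSeries.derivSeries_coeff_one, FormalMultilinearSeries.coeff_ofScalars]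
        simp
      · rw [hw.hasFDerivAt.fderiv]
        simp
    rw [hgw, ← hasSum_nat_add_iff' 1]
    simpa [pow_succ', mul_assoc] using h2.mul_left z
  have := hgp.eq_formalMultilinearSeries (hps hg')
  have h3 := congrArg (fun p => FormalMultilinearSeries.coeff p k) this
  simpa [FormalMultilinearSeries.coeff_ofScalars] using h3

theorem inner_of_mem_radialGraph (hr : 0 < r) {φ ψ : HardySpace r} (h : (φ, ψ) ∈ radialGraph r)
    (k : ℕ) : ⟪hardyMonomial r k, ψ⟫_ℂ = k * ⟪hardyMonomial r k, φ⟫_ℂ := by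
  have hs : ∀ χ : HardySpace r, ∀ z ∈ Metric.ball (0 : ℂ) r,
      HasSum (fun k => z ^ k * (⟪hardyMonomial r k, χ⟫_ℂ / r ^ k)) (holoExt χ z) := by
    intro χ z hz
    refine HasSum.of_eq (hasSum_holoExt hr χ hz) (fun k => ?_) rfl
    rw [div_pow]
    ring
  have h1 := coeff_eq_of_eq_mul_deriv hr (hs φ) (hs ψ) h k
  have hr0 : (r : ℂ) ^ k ≠ 0 := pow_ne_zero _ (Complex.ofReal_ne_zero.2 hr.ne')
  rw [← mul_div_assoc] at h1
  exact (div_left_inj' hr0).1 h1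

/-- The pairs in `radialGraph r` form the graph of an operator, since the second component is
determined by the Taylor coefficients of the first. -/
theorem graph_radialDeriv (hr : 0 < r) : (radialDeriv r).graph = radialGraph r := by
  refine Submodule.toLinearPMap_graph_eq _ ?_
  rintro ⟨φ, ψ⟩ hx h0
  simp only at h0
  subst h0
  refine ext_inner_basis (hardyBasis hr) fun k => ?_
  rw [hardyBasis_apply, inner_of_mem_radialGraph hr hx k]
  simp

/-- The maximal domain of `z ∂_z` is the one of the diagonal operator with eigenvalues `k`. -/
theorem isDiagonal_levelDirac (hr : 0 < r) (α β : ℝ) :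
    IsDiagonal (hardyBasis hr) (fun k => α * k + β) (levelDirac r α β) := by
  constructor
  · intro k
    have h : (hardyMonomial r k, (k : ℂ) • hardyMonomial r k) ∈ (radialDeriv r).graph := by
      rw [graph_radialDeriv hr]
      exact hardyMonomial_mem_radialGraph hr k
    obtain ⟨v, hv1, hv2⟩ := (LinearPMap.mem_graph_iff _).1 h
    refine (LinearPMap.mem_graph_iff _).2 ⟨⟨v.1, v.2⟩, ?_, ?_⟩
    · rw [hardyBasis_apply]; exact hv1
    · change (β : ℂ) • (v : HardySpace r) + (α : ℂ) • radialDeriv r v = _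
      simp only at hv1 hv2
      rw [hv1, hv2, hardyBasis_apply, smul_smul, ← add_smul]
      push_cast
      rw [add_comm]
  · rintro ⟨φ, ψ⟩ hx k
    obtain ⟨v, hv1, hv2⟩ := (LinearPMap.mem_graph_iff _).1 hx
    have hv : (v : HardySpace r) ∈ (radialDeriv r).domain := v.2
    have h := (radialDeriv r).mem_graph ⟨v.1, hv⟩
    rw [graph_radialDeriv hr] at h
    have h2 := inner_of_mem_radialGraph hr h k
    have hv3 : (β : ℂ) • (v : HardySpace r) + (α : ℂ) • radialDeriv r ⟨v.1, hv⟩ = ψ := hv2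
    simp only at hv1 h2 ⊢
    rw [← hv3, ← hv1, inner_add_right, inner_smul_right _ v.1,
      inner_smul_right _ (radialDeriv r ⟨v.1, hv⟩),
      hardyBasis_apply, h2]
    push_cast
    ring

end Hardy

/-! ### Hilbert direct sums of diagonal operators -/

section SumBasis

variable {ι κ : Type*} {H : ι → Type*} [∀ i, NormedAddCommGroup (H i)]
  [∀ i, InnerProductSpace ℂ (H i)]

open Classical in
/-- The vectors of the basis `e i` of the summand `H i`, in the Hilbert direct sum. -/
def sumVector (e : ∀ i, HilbertBasis κ ℂ (H i)) (x : ι × κ) : lp H 2 :=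
  lp.single 2 x.1 (e x.1 x.2)

theorem inner_sumVector_left (e : ∀ i, HilbertBasis κ ℂ (H i)) (i : ι) (k : κ) (v : lp H 2) :
    ⟪sumVector e (i, k), v⟫_ℂ = ⟪e i k, v i⟫_ℂ := by
  classical
  rw [sumVector, lp.inner_single_left]

theorem sumVector_apply_self (e : ∀ i, HilbertBasis κ ℂ (H i)) (i : ι) (k : κ) :
    sumVector e (i, k) i = e i k := by
  classical
  exact lp.single_apply_self _ _ _

theorem sumVector_apply_ne (e : ∀ i, HilbertBasis κ ℂ (H i)) {i j : ι} (h : j ≠ i) (k : κ) :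
    sumVector e (i, k) j = 0 := by
  classical
  exact lp.single_apply_ne _ _ _ h

theorem orthonormal_sumVector (e : ∀ i, HilbertBasis κ ℂ (H i)) : Orthonormal ℂ (sumVector e) := by
  classical
  rw [orthonormal_iff_ite]
  rintro ⟨i, j⟩ ⟨i', k⟩
  rw [inner_sumVector_left]
  by_cases h : i = i'
  · subst h
    rw [sumVector_apply_self, orthonormal_iff_ite.1 (e i).orthonormal]
    simp
  · rw [sumVector_apply_ne e h, inner_zero_right, if_neg (fun h' => h (congrArg Prod.fst h'))]

variable [∀ i, CompleteSpace (H i)]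

/-- Orthonormal bases of the summands form an orthonormal basis of the Hilbert direct sum. -/
def sumBasis (e : ∀ i, HilbertBasis κ ℂ (H i)) : HilbertBasis (ι × κ) ℂ (lp H 2) :=
  HilbertBasis.mkOfOrthogonalEqBot (orthonormal_sumVector e) <| by
    rw [eq_bot_iff]
    intro v hv
    refine (Submodule.mem_bot ℂ).2 (lp.ext (funext fun i => ext_inner_basis (e i) fun k => ?_))
    rw [← inner_sumVector_left, (Submodule.mem_orthogonal _ _).1 hv _
      (Submodule.subset_span ⟨(i, k), rfl⟩)]
    exact (inner_zero_right _).symm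

theorem sumBasis_apply (e : ∀ i, HilbertBasis κ ℂ (H i)) (x : ι × κ) :
    sumBasis e x = sumVector e x := by
  rw [sumBasis, HilbertBasis.coe_mkOfOrthogonalEqBot]

theorem isDiagonal_directSumPMap {e : ∀ i, HilbertBasis κ ℂ (H i)} {lam : ι → κ → ℝ}
    {D : ∀ i, H i →ₗ.[ℂ] H i} (h : ∀ i, IsDiagonal (e i) (lam i) (D i)) :
    IsDiagonal (sumBasis e) (fun x => lam x.1 x.2) (directSumPMap D) := by
  constructor
  · rintro ⟨i, k⟩
    rw [sumBasis_apply]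
    have hmem : sumVector e (i, k) ∈ (directSumPMap D).domain := by
      refine ⟨(finite_singleton i).subset fun j hj => ?_, fun j => ?_⟩
      · by_contra hne
        exact hj (sumVector_apply_ne e hne k)
      · by_cases hj : j = i
        · subst hj
          rw [sumVector_apply_self]
          exact LinearPMap.mem_domain_of_mem_graph ((h j).basis_mem k)
        · rw [sumVector_apply_ne e hj]
          exact zero_mem _
    refine (LinearPMap.mem_graph_iff _).2 ⟨⟨_, hmem⟩, rfl, lp.ext (funext fun j => ?_)⟩
    change D j ⟨sumVector e (i, k) j, hmem.2 j⟩ = (lam i k : ℂ) • sumVector e (i, k) j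
    refine LinearPMap.mem_graph_snd_inj (D j) (LinearPMap.mem_graph (D j) _) ?_ rfl
    by_cases hj : j = i
    · subst hj
      simp only [sumVector_apply_self]
      exact (h j).basis_mem k
    · simp only [sumVector_apply_ne e hj, smul_zero]
      exact zero_mem _
  · rintro ⟨v, w⟩ hx ⟨i, k⟩
    obtain ⟨u, rfl, rfl⟩ := (LinearPMap.mem_graph_iff _).1 hx
    rw [sumBasis_apply, inner_sumVector_left, inner_sumVector_left]
    exact (h i).inner_apply ⟨u.1 i, u.2.2 i⟩ k

/-- Commutators with a diagonal operator may be computed in each summand: the matrix of a direct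
sum of operators is block diagonal. -/
theorem commutator_directSum {e : ∀ i, HilbertBasis κ ℂ (H i)} {lam : ι → κ → ℝ}
    {T C : ∀ i, H i →L[ℂ] H i} {A B : ℝ} (hA : 0 ≤ A) (hT : ∀ i, ‖T i‖ ≤ A) (hB : 0 ≤ B)
    (hC : ∀ i, ‖C i‖ ≤ B)
    (h : ∀ i j k, ⟪e i j, C i (e i k)⟫_ℂ = (lam i j - lam i k) * ⟪e i j, T i (e i k)⟫_ℂ)
    (x y : ι × κ) : ⟪sumBasis e x, directSum C (sumBasis e y)⟫_ℂ =
      (lam x.1 x.2 - lam y.1 y.2) * ⟪sumBasis e x, directSum T (sumBasis e y)⟫_ℂ := by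
  obtain ⟨i, j⟩ := x
  obtain ⟨i', k⟩ := y
  simp only [sumBasis_apply]
  rw [inner_sumVector_left, inner_sumVector_left, directSum_apply C hB hC, directSum_apply T hA hT]
  by_cases hi : i = i'
  · subst hi
    rw [sumVector_apply_self]
    exact h i j k
  · rw [sumVector_apply_ne e hi, map_zero, map_zero, inner_zero_right, mul_zero]

theorem star_directSum {T : ∀ i, H i →L[ℂ] H i} {A : ℝ} (hA : 0 ≤ A) (hT : ∀ i, ‖T i‖ ≤ A) :
    star (directSum T) = directSum fun i => star (T i) := by
  have hT' : ∀ i, ‖star (T i)‖ ≤ A := fun i => by rw [norm_star]; exact hT i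
  rw [ContinuousLinearMap.star_eq_adjoint]
  refine ((ContinuousLinearMap.eq_adjoint_iff _ _).2 fun v w => ?_).symm
  rw [lp.inner_eq_tsum, lp.inner_eq_tsum]
  refine tsum_congr fun i => ?_
  rw [directSum_apply _ hA hT', directSum_apply _ hA hT, ContinuousLinearMap.star_eq_adjoint,
    ContinuousLinearMap.adjoint_inner_left]

end SumBasis

/-! ### The eigenvalues of the direct sum of the operators `α_m z ∂_z + β_m` -/

section Eigenvalues

variable {c : ℝ} {N : ℕ}

/-- The orthonormal basis of normalized monomials of all the `H_ω`. -/
def wordBasis (hc : 0 < c) (N : ℕ) : HilbertBasis (Word N × ℕ) ℂ (SumSpace c N) :=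
  sumBasis fun ω : Word N => hardyBasis (pow_pos hc ω.1)

theorem isDiagonal_sumDirac (hc : 0 < c) (α β : ℕ → ℝ) :
    IsDiagonal (wordBasis hc N) (fun x => α x.1.1 * x.2 + β x.1.1) (sumDirac c N α β) :=
  isDiagonal_directSumPMap fun ω : Word N => isDiagonal_levelDirac (pow_pos hc ω.1)
    (α ω.1) (β ω.1)

theorem tsum_word (q : ℝ≥0∞) : ∑' ω : Word N, q ^ ω.1 = (1 - N * q)⁻¹ := by
  rw [ENNReal.tsum_sigma', ← ENNReal.tsum_geometric]
  refine tsum_congr fun m => ?_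
  rw [tsum_fintype]
  simp [mul_pow]

theorem mul_rpow_lt_one_iff (hc : 0 < c) (hc1 : c < 1) (hN : 0 < N) (s : ℝ) :
    N * c ^ s < 1 ↔ Real.log N / Real.log (1 / c) < s := by
  have hN' : (0 : ℝ) < N := Nat.cast_pos.2 hN
  have hl : 0 < Real.log (1 / c) := Real.log_pos (by rw [lt_div_iff₀ hc]; linarith)
  rw [← Real.log_neg_iff (by positivity), Real.log_mul hN'.ne' (by positivity),
    Real.log_rpow hc, div_lt_iff₀ hl, one_div, Real.log_inv]
  constructor <;> intro h <;> linarith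

/-- The sum factors into a geometric series over the words and the series of `(k + 1)⁻ˢ`, which
converges because the critical exponent of the geometric series exceeds `1`. -/
theorem tsum_eigenvalue_lt_top_iff (hc : 0 < c) (hc1 : c < 1) (hcN : 1 < c * (N : ℝ)) (s : ℝ) :
    (∑' x : Word N × ℕ, ENNReal.ofReal (((c ^ x.1.1)⁻¹ * x.2 + (c ^ x.1.1)⁻¹)⁻¹ ^ s) < ⊤) ↔
      Real.log N / Real.log (1 / c) < s := by
  have hN : 0 < N := by
    rcases Nat.eq_zero_or_pos N with h | h
    · rw [h] at hcN; norm_num at hcN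
    · exact h
  have h1 : ∀ x : Word N × ℕ, ENNReal.ofReal (((c ^ x.1.1)⁻¹ * x.2 + (c ^ x.1.1)⁻¹)⁻¹ ^ s) =
      ENNReal.ofReal (c ^ s) ^ x.1.1 * ENNReal.ofReal (1 / ((x.2 + 1 : ℕ) : ℝ) ^ s) := by
    rintro ⟨ω, k⟩
    have hk : (0 : ℝ) ≤ ((k + 1 : ℕ) : ℝ)⁻¹ := by positivity
    rw [← ENNReal.ofReal_pow (by positivity), ← ENNReal.ofReal_mul (by positivity)]
    congr 1
    have : ((c ^ ω.1)⁻¹ * k + (c ^ ω.1)⁻¹)⁻¹ = c ^ ω.1 * ((k + 1 : ℕ) : ℝ)⁻¹ := by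
      have : (c ^ ω.1)⁻¹ * k + (c ^ ω.1)⁻¹ = (c ^ ω.1)⁻¹ * ((k + 1 : ℕ) : ℝ) := by
        push_cast; ring
      rw [this, mul_inv, inv_inv]
    rw [this, Real.mul_rpow (by positivity) hk, ← Real.rpow_natCast, ← Real.rpow_natCast,
      ← Real.rpow_mul hc.le, ← Real.rpow_mul hc.le, mul_comm s, one_div,
      Real.inv_rpow (by positivity)]
  simp only [h1]
  rw [ENNReal.tsum_prod (f := fun (ω : Word N) (k : ℕ) =>
    ENNReal.ofReal (c ^ s) ^ ω.1 * ENNReal.ofReal (1 / ((k + 1 : ℕ) : ℝ) ^ s))]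
  simp only [ENNReal.tsum_mul_left]
  rw [ENNReal.tsum_mul_right, tsum_word]
  have hiff := mul_rpow_lt_one_iff hc hc1 hN s
  have hgeo : (N : ℝ≥0∞) * ENNReal.ofReal (c ^ s) = ENNReal.ofReal (N * c ^ s) := by
    rw [ENNReal.ofReal_mul (by positivity), ENNReal.ofReal_natCast]
  rw [hgeo]
  constructor
  · intro h
    by_contra hns
    have hge : 1 ≤ N * c ^ s := not_lt.1 fun h' => hns (hiff.1 h')
    -- For `s ≤ d` the sum over the words diverges, and the other factor does not vanish.
    have htop : (1 - ENNReal.ofReal (N * c ^ s))⁻¹ = ⊤ := by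
      rw [tsub_eq_zero_of_le (ENNReal.one_le_ofReal.2 hge), ENNReal.inv_zero]
    rw [htop] at h
    refine h.ne (ENNReal.top_mul fun h0 => ?_)
    have := ENNReal.tsum_eq_zero.1 h0 0
    simp at this
  · intro hds
    have hlt := hiff.2 hds
    -- If `s ≤ 1`, then `c ≤ c ^ s`, and `N c ^ s < 1` contradicts `c N > 1`.
    have hs1 : 1 < s := by
      by_contra hle
      have h2 : c ≤ c ^ s := by
        conv_lhs => rw [← Real.rpow_one c]
        exact Real.rpow_le_rpow_of_exponent_ge hc hc1.le (not_lt.1 hle)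
      have h3 : c * (N : ℝ) ≤ N * c ^ s := by
        rw [mul_comm]; gcongr
      linarith
    refine ENNReal.mul_lt_top ?_ ?_
    · rw [ENNReal.inv_lt_top, tsub_pos_iff_lt]
      exact ENNReal.ofReal_lt_one.2 hlt
    · have := (summable_nat_add_iff 1).2 (Real.summable_one_div_nat_rpow.2 hs1)
      rw [← ENNReal.ofReal_tsum_of_nonneg (fun k => by positivity) this]
      exact ENNReal.ofReal_lt_top

theorem tendsto_atTop_of_tsum_lt_top {ι : Type*} {lam : ι → ℝ} (hpos : ∀ i, 0 < lam i) {s : ℝ}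
    (hs : 0 < s) (h : ∑' i, ENNReal.ofReal ((lam i)⁻¹ ^ s) < ⊤) :
    Filter.Tendsto lam Filter.cofinite Filter.atTop := by
  have h0 := ENNReal.tendsto_cofinite_zero_of_tsum_ne_top h.ne
  rw [Filter.tendsto_atTop]
  intro K
  have hK : (0 : ℝ) < (max K 1)⁻¹ ^ s := by positivity
  filter_upwards [h0.eventually_lt_const (ENNReal.ofReal_pos.2 hK)] with i hi
  have h1 := (ENNReal.ofReal_lt_ofReal_iff hK).1 hi
  have h2 := lt_of_not_ge fun hle => h1.not_ge (Real.rpow_le_rpow (by positivity) hle hs.le)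
  exact (le_max_left _ _).trans ((inv_lt_inv₀ (hpos i) (by positivity)).1 h2).le

end Eigenvalues

/-! ### Toeplitz operators -/

section Toeplitz

variable {r : ℝ}

theorem toeplitz_congr {u v : ℂ → ℂ} (h : u =ᵐ[circleMeasure r] v) :
    toeplitz r u = toeplitz r v := by
  unfold toeplitz
  by_cases hu : MemLp u ∞ (circleMeasure r)
  · have hv := (memLp_congr_ae h).1 hu
    rw [dif_pos hu, dif_pos hv, MemLp.toLp_congr hu hv h]
  · rw [dif_neg hu, dif_neg fun hv => hu ((memLp_congr_ae h).2 hv)]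

theorem norm_toeplitz_le {u : ℂ → ℂ} {K : ℝ} (hK : 0 ≤ K) (h : ∀ᵐ z ∂circleMeasure r, ‖u z‖ ≤ K) :
    ‖toeplitz r u‖ ≤ K := by
  unfold toeplitz
  split_ifs with hu
  · have h1 : ‖hu.toLp‖ ≤ K := by
      have h1 := Lp.norm_le_of_ae_bound (p := ∞) (f := hu.toLp) hK
        (by filter_upwards [h, hu.coeFn_toLp] with z hz hz'; rw [hz']; exact hz)
      simpa using h1
    have h2 : ‖(ContinuousLinearMap.mul ℂ ℂ).holderL (circleMeasure r) ∞ 2 2 hu.toLp‖ ≤ K := by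
      refine (ContinuousLinearMap.le_opNorm _ _).trans ?_
      calc _ ≤ 1 * K := mul_le_mul
            (((ContinuousLinearMap.mul ℂ ℂ).norm_holderL_le).trans
              (ContinuousLinearMap.opNorm_mul_le ℂ ℂ)) h1 (norm_nonneg _) zero_le_one
        _ = K := one_mul K
    refine ContinuousLinearMap.opNorm_le_bound _ hK fun φ => ?_
    refine ((HardySpace r).orthogonalProjectionOnto.le_of_opNorm_le
      (HardySpace r).orthogonalProjectionOnto_norm_le _).trans ?_
    rw [one_mul]
    exact ContinuousLinearMap.le_of_opNorm_le _ h2 _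
  · exact (norm_zero (E := HardySpace r →L[ℂ] HardySpace r)).le.trans hK

theorem inner_toeplitz {u : ℂ → ℂ} (hu : MemLp u ∞ (circleMeasure r)) (j k : ℕ) :
    ⟪hardyMonomial r j, toeplitz r u (hardyMonomial r k)⟫_ℂ =
      ∫ z, (starRingEnd ℂ) ((z / r) ^ j) * (u z * (z / r) ^ k) ∂circleMeasure r := by
  rw [toeplitz, dif_pos hu]
  refine (Submodule.inner_orthogonalProjectionOnto_eq_of_mem_left _ _).trans ?_
  rw [L2.inner_def]
  refine integral_congr_ae ?_
  filter_upwards [hardyMonomial_ae r j, hardyMonomial_ae r k, hu.coeFn_toLp,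
    (ContinuousLinearMap.mul ℂ ℂ).coeFn_holder (r := 2) hu.toLp (hardyMonomial r k).1]
    with z h1 h2 h3 h4
  rw [RCLike.inner_apply, h1, mul_comm]
  congr 1
  refine h4.trans ?_
  rw [h3, h2]
  rfl

theorem star_toeplitz (hr : 0 < r) {u : ℂ → ℂ} (hu : MemLp u ∞ (circleMeasure r)) :
    star (toeplitz r u) = toeplitz r fun z => (starRingEnd ℂ) (u z) := by
  refine ext_matrix (hardyBasis hr) fun i j => ?_
  have hu' : MemLp (fun z => (starRingEnd ℂ) (u z)) ∞ (circleMeasure r) := hu.star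
  rw [ContinuousLinearMap.star_eq_adjoint, ContinuousLinearMap.adjoint_inner_right,
    hardyBasis_apply, hardyBasis_apply, inner_toeplitz hu', ← inner_conj_symm, inner_toeplitz hu,
    ← integral_conj]
  refine integral_congr_ae (.of_forall fun z => ?_)
  simp only [map_mul, Complex.conj_conj]
  ring

/-- The angle in `[0, 2π)` of a point of the circle. -/
def circleAngle (z : ℂ) : ℝ := toIcoMod Real.two_pi_pos 0 (Complex.arg z)

theorem measurable_circleAngle : Measurable circleAngle := by
  unfold circleAngle
  simp only [toIcoMod_eq_fract_mul]
  exact (measurable_fract.comp (Complex.measurable_arg.div_const _)).mul_const _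

theorem circleAngle_mem (z : ℂ) : circleAngle z ∈ Ico 0 (2 * Real.pi) := by
  have h := toIcoMod_mem_Ico Real.two_pi_pos 0 (Complex.arg z)
  rwa [zero_add] at h

theorem circleAngle_circleMap (hr : 0 < r) {t : ℝ} (ht : t ∈ Ico 0 (2 * Real.pi)) :
    circleAngle (circleMap 0 r t) = t := by
  rw [circleAngle, circleMap_zero, Complex.arg_real_mul _ hr, Complex.arg_exp_mul_I,
    toIcoMod_toIocMod, toIcoMod_eq_self, zero_add]
  exact ht

theorem circleMap_circleAngle {z : ℂ} (hz : ‖z‖ = r) : circleMap 0 r (circleAngle z) = z := by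
  rw [circleAngle, toIcoMod, (periodic_circleMap 0 r).sub_zsmul_eq, circleMap_zero, ← hz,
    Complex.norm_mul_exp_arg_mul_I]

variable {g : ℝ → ℂ} {K : ℝ}

theorem memLp_comp_circleAngle (hg : Measurable g) (hK : ∀ t, ‖g t‖ ≤ K) :
    MemLp (g ∘ circleAngle) ∞ (circleMeasure r) :=
  memLp_top_of_bound (hg.comp measurable_circleAngle).aestronglyMeasurable K
    (.of_forall fun _ => hK _)

theorem inner_toeplitz_circleAngle (hr : 0 < r) (hg : Measurable g) (hK : ∀ t, ‖g t‖ ≤ K)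
    (j k : ℕ) : ⟪hardyMonomial r j, toeplitz r (g ∘ circleAngle) (hardyMonomial r k)⟫_ℂ =
      (2 * Real.pi : ℂ)⁻¹ * ∫ t in (0 : ℝ)..2 * Real.pi,
        g t * Complex.exp (Complex.I * ((k : ℤ) - (j : ℤ) : ℤ) * t) := by
  have hm : Measurable fun z : ℂ => (starRingEnd ℂ) ((z / r) ^ j) *
      ((g ∘ circleAngle) z * (z / r) ^ k) :=
    (Complex.continuous_conj.measurable.comp (by fun_prop)).mul
      ((hg.comp measurable_circleAngle).mul (by fun_prop))
  rw [inner_toeplitz (memLp_comp_circleAngle hg hK), integral_circleMeasure r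
    hm.aestronglyMeasurable]
  congr 1
  refine intervalIntegral.integral_congr_ae ?_
  have h0 : ∀ᵐ t : ℝ, t ≠ 2 * Real.pi := by
    simp [ae_iff, measure_singleton]
  filter_upwards [h0] with t ht0 ht
  rw [uIoc_of_le Real.two_pi_pos.le] at ht
  rw [← conj_pow_mul_pow hr, Function.comp_apply,
    circleAngle_circleMap hr ⟨ht.1.le, lt_of_le_of_ne ht.2 ht0⟩]
  ring

/-- If `g'` has the Fourier coefficients of the derivative of `g`, then the Toeplitz operator of
`-i α g'` is the commutator of `α z ∂_z + β` with that of `g`. -/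
theorem inner_toeplitz_commutator (hr : 0 < r) {g' : ℝ → ℂ} {K' : ℝ} (hg : Measurable g)
    (hK : ∀ t, ‖g t‖ ≤ K) (hg' : Measurable g') (hK' : ∀ t, ‖g' t‖ ≤ K') (α β : ℝ)
    (hF : ∀ n : ℤ, ∫ t in (0 : ℝ)..2 * Real.pi, g' t * Complex.exp (Complex.I * n * t) =
      -(Complex.I * n) * ∫ t in (0 : ℝ)..2 * Real.pi, g t * Complex.exp (Complex.I * n * t))
    (j k : ℕ) :
    ⟪hardyBasis hr j, ((-Complex.I * α) • toeplitz r (g' ∘ circleAngle)) (hardyBasis hr k)⟫_ℂ =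
      (((α * j + β : ℝ) : ℂ) - ((α * k + β : ℝ) : ℂ)) *
        ⟪hardyBasis hr j, toeplitz r (g ∘ circleAngle) (hardyBasis hr k)⟫_ℂ := by
  simp only [hardyBasis_apply]
  rw [smul_apply, inner_smul_right (hardyMonomial r j)
    (toeplitz r (g' ∘ circleAngle) (hardyMonomial r k)), inner_toeplitz_circleAngle hr hg hK,
    inner_toeplitz_circleAngle hr hg' hK', hF]
  push_cast
  linear_combination ((2 * Real.pi : ℂ)⁻¹ * α * ((k : ℂ) - j) *
    ∫ t in (0 : ℝ)..2 * Real.pi, g t * Complex.exp (Complex.I * ((k : ℂ) - j) * t)) *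
      Complex.I_mul_I

end Toeplitz

/-! ### Polygonal Jordan curves -/

section Polygon

variable {M : ℕ} [NeZero M] {p : Fin M → ℂ}

theorem add_one_ne (hp : IsPolygonalJordan p) (j : Fin M) : j + 1 ≠ j := by
  intro h
  have h1 : (1 : Fin M) = 0 := by simpa using h
  have h2 := congrArg Fin.val h1
  have := hp.two_lt
  rw [Fin.val_one', Nat.mod_eq_of_lt (by omega)] at h2
  simp at h2

theorem add_one_add_one_ne (hp : IsPolygonalJordan p) (j : Fin M) : j + 1 + 1 ≠ j := by
  intro h
  rw [add_assoc] at h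
  have h1 : (1 + 1 : Fin M) = 0 := by simpa using h
  have h2 := congrArg Fin.val h1
  have := hp.two_lt
  rw [Fin.val_add, Fin.val_one', Nat.mod_eq_of_lt (a := 1) (by omega),
    Nat.mod_eq_of_lt (by omega)] at h2
  simp at h2

theorem sideLength_pos (hp : IsPolygonalJordan p) (j : Fin M) : 0 < sideLength p j := by
  rw [sideLength, norm_pos_iff, sub_ne_zero]
  intro h
  refine add_one_ne hp j (congrArg Prod.fst (hp.injective (x₁ := (j + 1, (0 : ℝ)))
    (x₂ := (j, (0 : ℝ))) (by simp) (by simp) ?_))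
  simpa using h

open Fin.CommRing in
/-- The sides other than the `j`-th and the next one form a path from `p_{j+2}` to `p_j`. -/
theorem two_sides_add_dist_le (hp : IsPolygonalJordan p) (j : Fin M) :
    sideLength p j + sideLength p (j + 1) + dist (p (j + 1 + 1)) (p j) ≤
      ∑ l, sideLength p l := by
  have hM := hp.two_lt
  let f : ℕ → ℂ := fun i => p (j + (i : Fin M))
  have hf : ∀ i, dist (f i) (f (i + 1)) = sideLength p (j + (i : Fin M)) := fun i => by
    simp only [f]
    rw [dist_comm, dist_eq_norm, sideLength, Nat.cast_succ, add_assoc]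
  have hsum : ∑ i ∈ Finset.range M, dist (f i) (f (i + 1)) = ∑ l, sideLength p l := by
    simp only [hf]
    rw [Finset.sum_range]
    simp only [Fin.cast_val_eq_self]
    exact Equiv.sum_comp (Equiv.addLeft j) (sideLength p)
  have h2 := dist_le_Ico_sum_dist f (m := 2) (n := M) hM.le
  have h3 := Finset.sum_range_add_sum_Ico (fun i => dist (f i) (f (i + 1))) hM.le
  rw [hsum, Finset.sum_range_succ, Finset.sum_range_one, hf, hf] at h3
  have e2 : f 2 = p (j + 1 + 1) := by
    simp only [f]
    congr 1
    push_cast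
    ring
  have eM : f M = p j := by
    simp [f]
  rw [e2, eM] at h2
  simp only [Nat.cast_zero, add_zero, Nat.cast_one] at h3
  linarith

/-- A side of a polygonal Jordan curve is shorter than the rest of the curve: otherwise the
following vertex would lie on it. -/
theorem sideLength_lt_half (hp : IsPolygonalJordan p) (j : Fin M) :
    2 * sideLength p j < ∑ l, sideLength p l := by
  have h1 := two_sides_add_dist_le hp j
  have hj : sideLength p j = dist (p (j + 1)) (p j) := by rw [dist_eq_norm, sideLength]
  have hj1 : sideLength p (j + 1) = dist (p (j + 1)) (p (j + 1 + 1)) := by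
    rw [dist_comm, dist_eq_norm, sideLength]
  have h2 := dist_triangle (p (j + 1)) (p (j + 1 + 1)) (p j)
  by_contra hlt
  have heq : dist (p (j + 1)) (p (j + 1 + 1)) + dist (p (j + 1 + 1)) (p j) =
      dist (p (j + 1)) (p j) := by linarith
  have hw : Wbtw ℝ (p j) (p (j + 1 + 1)) (p (j + 1)) := (dist_add_dist_eq_iff.1 heq).symm
  obtain ⟨x, hx, hx2⟩ := hw
  rw [AffineMap.lineMap_apply_module'] at hx2
  have hinj : ∀ {y z : Fin M × ℝ}, y.2 ∈ Ico (0 : ℝ) 1 → z.2 ∈ Ico (0 : ℝ) 1 →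
      p y.1 + (y.2 : ℂ) * (p (y.1 + 1) - p y.1) = p z.1 + (z.2 : ℂ) * (p (z.1 + 1) - p z.1) →
      y = z := fun hy hz h => hp.injective ⟨mem_univ _, hy⟩ ⟨mem_univ _, hz⟩ h
  have hx2' : p (j + 1 + 1) = p j + (x : ℂ) * (p (j + 1) - p j) := by
    rw [← hx2, Complex.real_smul, add_comm]
  -- Either `p_{j+2} = p_{j+1}`, or `p_{j+2}` is a point of the half-open `j`-th side.
  rcases eq_or_lt_of_le hx.2 with h | h
  · rw [h] at hx2'
    have := hinj (y := (j + 1 + 1, 0)) (z := (j + 1, 0)) (by simp) (by simp) (by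
      simp [hx2'])
    exact add_one_ne hp (j + 1) (congrArg Prod.fst this)
  · have := hinj (y := (j + 1 + 1, 0)) (z := (j, x)) (by simp) ⟨hx.1, h⟩ (by
      rw [← hx2']; simp)
    exact add_one_add_one_ne hp j (congrArg Prod.fst this)

/-! ### Functions on the circle given arc by arc -/

theorem angle_add_le_of_lt {i j : Fin M} (h : i < j) :
    angle p i + sideLength p i ≤ angle p j := by
  unfold angle
  rw [add_comm, ← Finset.sum_insert (by simp)]
  refine Finset.sum_le_sum_of_subset_of_nonneg (fun l hl => ?_) fun l _ _ => norm_nonneg _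
  rcases Finset.mem_insert.1 hl with rfl | hl
  · exact Finset.mem_Iio.2 h
  · exact Finset.mem_Iio.2 ((Finset.mem_Iio.1 hl).trans h)

/-- The length of the first `n` sides. -/
def partialLength (p : Fin M → ℂ) (n : ℕ) : ℝ := ∑ l, if l.val < n then sideLength p l else 0

theorem partialLength_zero : partialLength p 0 = 0 := by simp [partialLength]

theorem partialLength_self : partialLength p M = ∑ l, sideLength p l := by simp [partialLength]

theorem partialLength_val (j : Fin M) : partialLength p j = angle p j := by
  rw [partialLength, ← Finset.sum_filter, angle]
  congr 1
  ext l
  rw [Finset.mem_filter, Finset.mem_Iio, Fin.lt_def]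
  simp

theorem partialLength_val_add_one (j : Fin M) :
    partialLength p (j + 1 : ℕ) = angle p j + sideLength p j := by
  rw [partialLength, ← Finset.sum_filter, angle, add_comm (Finset.sum _ _),
    ← Finset.sum_insert (by simp)]
  congr 1
  ext l
  simp only [Finset.mem_filter, Finset.mem_univ, true_and, Finset.mem_insert, Finset.mem_Iio,
    Fin.lt_def, Fin.ext_iff]
  omega

theorem angle_add_le (hper : ∑ l, sideLength p l = 2 * Real.pi) (j : Fin M) :
    angle p j + sideLength p j ≤ 2 * Real.pi := by
  rw [← hper, ← partialLength_val_add_one, partialLength]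
  refine Finset.sum_le_sum fun l _ => ?_
  split_ifs
  · exact le_rfl
  · exact norm_nonneg _

theorem exists_arc (hper : ∑ l, sideLength p l = 2 * Real.pi) {t : ℝ}
    (ht : t ∈ Ico 0 (2 * Real.pi)) :
    ∃ j, angle p j ≤ t ∧ t < angle p j + sideLength p j := by
  have key : ∀ n ≤ M, t < partialLength p n →
      ∃ j, angle p j ≤ t ∧ t < angle p j + sideLength p j := by
    intro n
    induction n with
    | zero => intro _ h; rw [partialLength_zero] at h; exact absurd h ht.1.not_gt
    | succ n ih =>
      intro hn h
      by_cases h' : t < partialLength p n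
      · exact ih (by omega) h'
      · refine ⟨⟨n, hn⟩, ?_, ?_⟩
        · rw [← partialLength_val]; exact not_lt.1 h'
        · rw [← partialLength_val_add_one]; exact h
  refine key M le_rfl ?_
  rw [partialLength_self, hper]
  exact ht.2

/-- The end of an arc is the beginning of the next one, modulo the length `2π` of the circle. -/
theorem exp_angle_add (hper : ∑ l, sideLength p l = 2 * Real.pi) (n : ℤ) (j : Fin M) :
    Complex.exp (Complex.I * n * ((angle p j + sideLength p j : ℝ) : ℂ)) =
      Complex.exp (Complex.I * n * (angle p (j + 1) : ℂ)) := by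
  have hv : (j + 1).val = (j.val + 1) % M := by
    rw [Fin.val_add, Fin.val_one', Nat.add_mod_mod]
  rw [← partialLength_val_add_one, ← partialLength_val (j + 1), hv]
  rcases Nat.lt_or_ge (j.val + 1) M with h | h
  · rw [Nat.mod_eq_of_lt h]
  · have h' : j.val + 1 = M := le_antisymm j.isLt h
    rw [h', Nat.mod_self, partialLength_zero, partialLength_self, hper, Complex.ofReal_zero,
      mul_zero, Complex.exp_zero, Complex.exp_eq_one_iff]
    exact ⟨n, by push_cast; ring⟩

open Classical in
/-- The function on the circle which is `G j` on the `j`-th arc, closed at its beginning and open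
at its end; at most one summand differs from `0`. -/
def arcSum (p : Fin M → ℂ) (G : Fin M → ℝ → ℂ) (t : ℝ) : ℂ :=
  ∑ j, if angle p j ≤ t ∧ t < angle p j + sideLength p j then G j t else 0

theorem arcSum_eq (G : Fin M → ℝ → ℂ) {j : Fin M} {t : ℝ}
    (ht : angle p j ≤ t ∧ t < angle p j + sideLength p j) : arcSum p G t = G j t := by
  rw [arcSum, Finset.sum_eq_single j (fun i _ hi => ?_) (fun h => absurd (Finset.mem_univ _) h),
    if_pos ht]
  refine if_neg fun hi' => ?_
  rcases lt_or_gt_of_ne hi with h | h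
  · have := angle_add_le_of_lt (p := p) h
    linarith [hi'.2, ht.1]
  · have := angle_add_le_of_lt (p := p) h
    linarith [hi'.1, ht.2]

theorem measurable_arcSum {G : Fin M → ℝ → ℂ} (hG : ∀ j, Measurable (G j)) :
    Measurable (arcSum p G) := by
  classical
  unfold arcSum
  refine Finset.measurable_sum _ fun j _ => Measurable.ite ?_ (hG j) measurable_const
  exact measurableSet_Ico

theorem norm_arcSum_le {G : Fin M → ℝ → ℂ} {K : ℝ} (hK : 0 ≤ K)
    (hG : ∀ j, ∀ t ∈ Icc (angle p j) (angle p j + sideLength p j), ‖G j t‖ ≤ K) (t : ℝ) :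
    ‖arcSum p G t‖ ≤ K := by
  by_cases h : ∃ j, angle p j ≤ t ∧ t < angle p j + sideLength p j
  · obtain ⟨j, hj⟩ := h
    rw [arcSum_eq G hj]
    exact hG j t ⟨hj.1, hj.2.le⟩
  · rw [arcSum, Finset.sum_eq_zero fun j _ => if_neg fun hj => h ⟨j, hj⟩, norm_zero]
    exact hK

theorem integral_arcSum (hper : ∑ l, sideLength p l = 2 * Real.pi) {G : Fin M → ℝ → ℂ}
    (hGm : ∀ j, Measurable (G j)) {K : ℝ} (hK : 0 ≤ K)
    (hG : ∀ j, ∀ t ∈ Icc (angle p j) (angle p j + sideLength p j), ‖G j t‖ ≤ K)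
    {h : ℝ → ℂ} (hh : Continuous h) :
    ∫ t in (0 : ℝ)..2 * Real.pi, arcSum p G t * h t =
      ∑ j, ∫ t in angle p j..angle p j + sideLength p j, G j t * h t := by
  have hint : ∀ x y : ℝ, IntervalIntegrable (fun t => arcSum p G t * h t) volume x y := by
    intro x y
    refine IntervalIntegrable.mul_continuousOn ?_ hh.continuousOn
    rw [intervalIntegrable_iff]
    exact Measure.integrableOn_of_bounded (M := K) (by simp)
      (measurable_arcSum hGm).aestronglyMeasurable (.of_forall fun t => norm_arcSum_le hK hG t)
  have h1 := intervalIntegral.sum_integral_adjacent_intervals (μ := volume)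
    (f := fun t => arcSum p G t * h t) (a := partialLength p) (n := M) fun k _ => hint _ _
  rw [partialLength_zero, partialLength_self, hper] at h1
  rw [← h1, Finset.sum_range]
  refine Finset.sum_congr rfl fun j _ => ?_
  rw [partialLength_val, partialLength_val_add_one]
  have hle : angle p j ≤ angle p j + sideLength p j := le_add_of_nonneg_right (norm_nonneg _)
  refine intervalIntegral.integral_congr_ae ?_
  have h0 : ∀ᵐ t : ℝ, t ≠ angle p j + sideLength p j := by
    simp [ae_iff, measure_singleton]
  filter_upwards [h0] with t ht0 ht
  rw [uIoc_of_le hle] at ht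
  rw [arcSum_eq G ⟨ht.1.le, lt_of_le_of_ne ht.2 ht0⟩]

/-- Integration by parts on each arc: the boundary terms cancel along the closed curve. -/
theorem integral_arcSum_deriv (hper : ∑ l, sideLength p l = 2 * Real.pi) {G G' : Fin M → ℝ → ℂ}
    (hGm : ∀ j, Measurable (G j)) (hGm' : ∀ j, Measurable (G' j)) {K K' : ℝ} (hK : 0 ≤ K)
    (hK' : 0 ≤ K') (hG : ∀ j, ∀ t ∈ Icc (angle p j) (angle p j + sideLength p j), ‖G j t‖ ≤ K)
    (hG' : ∀ j, ∀ t ∈ Icc (angle p j) (angle p j + sideLength p j), ‖G' j t‖ ≤ K')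
    (hd : ∀ j, ∀ t ∈ Icc (angle p j) (angle p j + sideLength p j), HasDerivAt (G j) (G' j t) t)
    {v : Fin M → ℂ} (hv : ∀ j, G j (angle p j) = v j)
    (hv' : ∀ j, G j (angle p j + sideLength p j) = v (j + 1)) (n : ℤ) :
    ∫ t in (0 : ℝ)..2 * Real.pi, arcSum p G' t * Complex.exp (Complex.I * n * t) =
      -(Complex.I * n) *
        ∫ t in (0 : ℝ)..2 * Real.pi, arcSum p G t * Complex.exp (Complex.I * n * t) := by
  have he : Continuous fun t : ℝ => Complex.exp (Complex.I * n * t) := by fun_prop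
  rw [integral_arcSum hper hGm hK hG he, integral_arcSum hper hGm' hK' hG' he, Finset.mul_sum,
    ← sub_eq_zero, ← Finset.sum_sub_distrib]
  have key : ∀ j, (∫ t in angle p j..angle p j + sideLength p j,
        G' j t * Complex.exp (Complex.I * n * t)) -
      -(Complex.I * n) * (∫ t in angle p j..angle p j + sideLength p j,
        G j t * Complex.exp (Complex.I * n * t)) =
      v (j + 1) * Complex.exp (Complex.I * n * (angle p (j + 1) : ℂ)) -
        v j * Complex.exp (Complex.I * n * (angle p j : ℂ)) := by
    intro j
    have hle : angle p j ≤ angle p j + sideLength p j := le_add_of_nonneg_right (norm_nonneg _)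
    have hint : ∀ {Q : ℝ → ℂ} {B : ℝ}, Measurable Q →
        (∀ t ∈ Icc (angle p j) (angle p j + sideLength p j), ‖Q t‖ ≤ B) →
        IntervalIntegrable (fun t => Q t * Complex.exp (Complex.I * n * t)) volume (angle p j)
          (angle p j + sideLength p j) := by
      intro Q B hQ hB
      refine IntervalIntegrable.mul_continuousOn ?_ he.continuousOn
      rw [intervalIntegrable_iff, uIoc_of_le hle]
      exact Measure.integrableOn_of_bounded (M := B) (by simp) hQ.aestronglyMeasurable
        ((ae_restrict_iff' measurableSet_Ioc).2
          (.of_forall fun t ht => hB t (Ioc_subset_Icc_self ht)))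
    have h1 := hint (hGm j) (hG j)
    have h2 := hint (hGm' j) (hG' j)
    have h3 := intervalIntegral.integral_eq_sub_of_hasDerivAt
      (f := fun t : ℝ => G j t * Complex.exp (Complex.I * n * t))
      (f' := fun t => G' j t * Complex.exp (Complex.I * n * t) +
        Complex.I * n * (G j t * Complex.exp (Complex.I * n * t)))
      (a := angle p j) (b := angle p j + sideLength p j) (fun t ht => by
        rw [uIcc_of_le hle] at ht
        have hexp : HasDerivAt (fun t : ℝ => Complex.exp (Complex.I * n * t))
            (Complex.exp (Complex.I * n * t) * (Complex.I * n * 1)) t :=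
          ((Complex.ofRealCLM.hasDerivAt (x := t)).const_mul (Complex.I * (n : ℂ))).cexp
        refine ((hd j t ht).mul hexp).congr_deriv ?_
        ring) (h2.add (h1.const_mul _))
    rw [intervalIntegral.integral_add h2 (h1.const_mul _), intervalIntegral.integral_const_mul,
      hv, hv', exp_angle_add hper] at h3
    rw [← h3]
    ring
  rw [Finset.sum_congr rfl fun j _ => key j, Finset.sum_sub_distrib, sub_eq_zero]
  exact Equiv.sum_comp (Equiv.addRight (1 : Fin M))
    fun j => v j * Complex.exp (Complex.I * n * (angle p j : ℂ))

end Polygon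

/-! ### The symbols `P ∘ κ_ω` -/

section Symbols

variable {M : ℕ} [NeZero M] {p : Fin M → ℂ}

/-- The parameter in `[0, 1]` of the point of the `j`-th side which corresponds to the angle `t`. -/
def sideParam (p : Fin M → ℂ) (j : Fin M) (t : ℝ) : ℝ :=
  Real.tan ((t - angle p j) / 2) / Real.tan (sideLength p j / 2)

/-- The derivative of `sideParam p j`. -/
def sideParamDeriv (p : Fin M → ℂ) (j : Fin M) (t : ℝ) : ℝ :=
  1 / Real.cos ((t - angle p j) / 2) ^ 2 * (1 / 2) / Real.tan (sideLength p j / 2)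

theorem half_angle_mem (hp : IsPolygonalJordan p) (hper : ∑ l, sideLength p l = 2 * Real.pi)
    {j : Fin M} {t : ℝ} (ht : t ∈ Icc (angle p j) (angle p j + sideLength p j)) :
    0 ≤ (t - angle p j) / 2 ∧ (t - angle p j) / 2 ≤ sideLength p j / 2 ∧
      0 < sideLength p j / 2 ∧ sideLength p j / 2 < Real.pi / 2 := by
  have h1 := sideLength_lt_half hp j
  have h2 := sideLength_pos hp j
  rw [hper] at h1
  refine ⟨?_, ?_, ?_, ?_⟩ <;> linarith [ht.1, ht.2]

theorem tan_half_side_pos (hp : IsPolygonalJordan p) (hper : ∑ l, sideLength p l = 2 * Real.pi)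
    (j : Fin M) : 0 < Real.tan (sideLength p j / 2) := by
  have h := half_angle_mem hp hper (left_mem_Icc.2 (le_add_of_nonneg_right (norm_nonneg _)) :
    angle p j ∈ Icc (angle p j) (angle p j + sideLength p j))
  exact Real.tan_pos_of_pos_of_lt_pi_div_two h.2.2.1 h.2.2.2

theorem cos_half_pos (hp : IsPolygonalJordan p) (hper : ∑ l, sideLength p l = 2 * Real.pi)
    {j : Fin M} {t : ℝ} (ht : t ∈ Icc (angle p j) (angle p j + sideLength p j)) :
    0 < Real.cos ((t - angle p j) / 2) := by
  have h := half_angle_mem hp hper ht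
  exact Real.cos_pos_of_mem_Ioo ⟨by linarith, by linarith⟩

theorem sideParam_mem (hp : IsPolygonalJordan p) (hper : ∑ l, sideLength p l = 2 * Real.pi)
    {j : Fin M} {t : ℝ} (ht : t ∈ Icc (angle p j) (angle p j + sideLength p j)) :
    sideParam p j t ∈ Icc (0 : ℝ) 1 := by
  have h := half_angle_mem hp hper ht
  have ht0 := tan_half_side_pos hp hper j
  refine ⟨div_nonneg (Real.tan_nonneg_of_nonneg_of_le_pi_div_two h.1 (by linarith)) ht0.le, ?_⟩
  rw [sideParam, div_le_one ht0]
  exact Real.strictMonoOn_tan.monotoneOn ⟨by linarith, by linarith⟩ ⟨by linarith, by linarith⟩ h.2.1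

theorem sideParam_left (j : Fin M) : sideParam p j (angle p j) = 0 := by simp [sideParam]

theorem sideParam_right (hp : IsPolygonalJordan p) (hper : ∑ l, sideLength p l = 2 * Real.pi)
    (j : Fin M) : sideParam p j (angle p j + sideLength p j) = 1 := by
  rw [sideParam, add_sub_cancel_left, div_self (tan_half_side_pos hp hper j).ne']

theorem hasDerivAt_sideParam (hp : IsPolygonalJordan p)
    (hper : ∑ l, sideLength p l = 2 * Real.pi) {j : Fin M} {t : ℝ}
    (ht : t ∈ Icc (angle p j) (angle p j + sideLength p j)) :
    HasDerivAt (sideParam p j) (sideParamDeriv p j t) t := by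
  have h1 : HasDerivAt (fun t : ℝ => (t - angle p j) / 2) (1 / 2) t :=
    ((hasDerivAt_id t).sub_const _).div_const 2
  exact ((Real.hasDerivAt_tan (cos_half_pos hp hper ht).ne').comp t h1).div_const _

/-- The derivative is largest at the end of the arc, where the cosine is smallest. -/
theorem abs_sideParamDeriv_le (hp : IsPolygonalJordan p)
    (hper : ∑ l, sideLength p l = 2 * Real.pi) {j : Fin M} {t : ℝ}
    (ht : t ∈ Icc (angle p j) (angle p j + sideLength p j)) :
    |sideParamDeriv p j t| ≤ sideParamDeriv p j (angle p j + sideLength p j) := by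
  have h := half_angle_mem hp hper ht
  have ht0 := tan_half_side_pos hp hper j
  have hle : angle p j ≤ angle p j + sideLength p j := le_add_of_nonneg_right (norm_nonneg _)
  have hc := cos_half_pos hp hper (right_mem_Icc.2 hle)
  have hle' : Real.cos ((angle p j + sideLength p j - angle p j) / 2) ≤
      Real.cos ((t - angle p j) / 2) :=
    Real.cos_le_cos_of_nonneg_of_le_pi h.1 (by rw [add_sub_cancel_left]; linarith)
      (by rw [add_sub_cancel_left]; exact h.2.1)
  have hc' := hc.trans_le hle'
  rw [abs_of_nonneg (by unfold sideParamDeriv; positivity)]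
  unfold sideParamDeriv
  gcongr

theorem measurable_tan : Measurable Real.tan := by
  have : Real.tan = fun x => Real.sin x / Real.cos x := funext Real.tan_eq_sin_div_cos
  rw [this]
  fun_prop

theorem measurable_sideParam (j : Fin M) : Measurable (sideParam p j) :=
  (measurable_tan.comp (by fun_prop)).div_const _

theorem measurable_sideParamDeriv (j : Fin M) : Measurable (sideParamDeriv p j) := by
  unfold sideParamDeriv
  fun_prop

/-- The parametrization of the `j`-th side of the polygon with vertices `q` by the angle. -/
def sidePoint (p q : Fin M → ℂ) (j : Fin M) (t : ℝ) : ℂ :=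
  q j + (q (j + 1) - q j) * sideParam p j t

/-- With `z = r e^{it}` and `s = (t - θ_j) / 2`, the quotient `(z - ζ) / (z + ζ)` in the Möbius
map is `i tan s`. -/
theorem kappaSide_circleMap {q : Fin M → ℂ} {r : ℝ} (hr : 0 < r) {j : Fin M} {t : ℝ}
    (hc : Real.cos ((t - angle p j) / 2) ≠ 0) :
    kappaSide p q r j (circleMap 0 r t) = sidePoint p q j t := by
  simp only [kappaSide, sidePoint, sideParam]
  set s : ℝ := (t - angle p j) / 2 with hs
  set τ : ℝ := Real.tan (sideLength p j / 2)
  set ζ : ℂ := r * Complex.exp (Complex.I * angle p j) with hζ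
  set w : ℂ := Complex.exp (s * Complex.I) with hw
  have hζ0 : ζ ≠ 0 := mul_ne_zero (Complex.ofReal_ne_zero.2 hr.ne') (Complex.exp_ne_zero _)
  have hz : circleMap 0 r t = ζ * w ^ 2 := by
    rw [circleMap_zero, hζ, hw, mul_assoc, ← Complex.exp_nat_mul, ← Complex.exp_add]
    congr 2
    rw [hs]
    push_cast
    ring
  have hw' : w = Real.cos s + Real.sin s * Complex.I := by
    rw [hw, Complex.exp_mul_I]
    push_cast
    rfl
  have hcc : (Real.cos s : ℂ) ≠ 0 := Complex.ofReal_ne_zero.2 hc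
  have hsq : (Real.sin s : ℂ) ^ 2 + (Real.cos s : ℂ) ^ 2 = 1 := by
    exact_mod_cast Real.sin_sq_add_cos_sq s
  have hw0 : w ≠ 0 := Complex.exp_ne_zero _
  have hplus : w ^ 2 + 1 = 2 * Real.cos s * w := by
    rw [hw']
    linear_combination -hsq + (Real.sin s : ℂ) ^ 2 * Complex.I_sq
  have hminus : w ^ 2 - 1 = 2 * Complex.I * Real.sin s * w := by
    rw [hw']
    linear_combination hsq - (Real.sin s : ℂ) ^ 2 * Complex.I_sq
  have hden : ζ * w ^ 2 + ζ = ζ * (2 * Real.cos s * w) := by rw [← hplus]; ring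
  have hne : ζ * (2 * Real.cos s * w) ≠ 0 :=
    mul_ne_zero hζ0 (mul_ne_zero (mul_ne_zero two_ne_zero hcc) hw0)
  have hinv : Complex.I / ((q (j + 1) - q j)⁻¹ * (τ : ℂ)) =
      Complex.I * ((q (j + 1) - q j) * (τ : ℂ)⁻¹) := by
    rw [div_eq_mul_inv, mul_inv, inv_inv]
  rw [hz, hden, hinv, div_eq_iff hne, Real.tan_eq_sin_div_cos]
  push_cast
  set Q := (q (j + 1) - q j)
  have e1 : (q j - Complex.I * (Q * (τ : ℂ)⁻¹)) * (ζ * w ^ 2) +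
      ζ * (q j + Complex.I * (Q * (τ : ℂ)⁻¹)) =
      q j * (ζ * (w ^ 2 + 1)) - Complex.I * (Q * (τ : ℂ)⁻¹) * (ζ * (w ^ 2 - 1)) := by ring
  rw [e1, hplus, hminus]
  push_cast at hcc ⊢
  rw [div_div, div_eq_mul_inv, mul_inv]
  have hcancel : (Complex.cos s)⁻¹ * Complex.cos s = 1 := inv_mul_cancel₀ hcc
  linear_combination (-2 * Q * (τ : ℂ)⁻¹ * ζ * Complex.sin s * w) * Complex.I_sq -
    (2 * Q * Complex.sin s * (τ : ℂ)⁻¹ * ζ * w) * hcancel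

theorem kappa_eq_arcSum (hp : IsPolygonalJordan p) (hper : ∑ l, sideLength p l = 2 * Real.pi)
    {q : Fin M → ℂ} {r : ℝ} (hr : 0 < r) {z : ℂ} (hz : ‖z‖ = r) :
    kappa p q r z = arcSum p (sidePoint p q) (circleAngle z) := by
  classical
  unfold kappa arcSum
  refine Finset.sum_congr rfl fun j _ => ?_
  change (if angle p j ≤ circleAngle z ∧ circleAngle z < angle p j + sideLength p j then
    kappaSide p q r j z else 0) = _
  split_ifs with h
  · rw [← kappaSide_circleMap hr (cos_half_pos hp hper ⟨h.1, h.2.le⟩).ne',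
      circleMap_circleAngle hz]
  · rfl

theorem polyFun_C (x z : ℂ) : polyFun (MvPolynomial.C x) z = x := by simp [polyFun]

theorem polyFun_add (P Q : MvPolynomial (Fin 2) ℂ) (z : ℂ) :
    polyFun (P + Q) z = polyFun P z + polyFun Q z := by simp [polyFun]

theorem polyFun_mul (P Q : MvPolynomial (Fin 2) ℂ) (z : ℂ) :
    polyFun (P * Q) z = polyFun P z * polyFun Q z := by simp [polyFun]

theorem polyFun_X_zero (z : ℂ) : polyFun (MvPolynomial.X 0) z = z := by simp [polyFun]

theorem polyFun_X_one (z : ℂ) : polyFun (MvPolynomial.X 1) z = (starRingEnd ℂ) z := by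
  simp [polyFun]

theorem contDiff_polyFun (P : MvPolynomial (Fin 2) ℂ) : ContDiff ℝ 1 (polyFun P) := by
  induction P using MvPolynomial.induction_on with
  | C x => rw [show polyFun (MvPolynomial.C x) = fun _ => x from funext (polyFun_C x)]; fun_prop
  | add P Q hP hQ => rw [show polyFun (P + Q) = _ from funext (polyFun_add P Q)]; exact hP.add hQ
  | mul_X P i hP =>
    rw [show polyFun (P * MvPolynomial.X i) = _ from funext (polyFun_mul P _)]
    refine hP.mul ?_
    fin_cases i
    · exact (funext polyFun_X_zero : _ = id) ▸ contDiff_id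
    · exact (funext polyFun_X_one : _ = ⇑Complex.conjCLE) ▸ Complex.conjCLE.contDiff

/-- Complex conjugation of the symbols: conjugate the coefficients and exchange `z` and `z̄`. -/
theorem exists_polyFun_conj (P : MvPolynomial (Fin 2) ℂ) :
    ∃ Q : MvPolynomial (Fin 2) ℂ, ∀ z, polyFun Q z = (starRingEnd ℂ) (polyFun P z) := by
  induction P using MvPolynomial.induction_on with
  | C x => exact ⟨MvPolynomial.C ((starRingEnd ℂ) x), fun z => by rw [polyFun_C, polyFun_C]⟩
  | add P P' hP hP' =>
    obtain ⟨Q, hQ⟩ := hP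
    obtain ⟨Q', hQ'⟩ := hP'
    exact ⟨Q + Q', fun z => by rw [polyFun_add, polyFun_add, hQ, hQ', map_add]⟩
  | mul_X P i hP =>
    obtain ⟨Q, hQ⟩ := hP
    refine ⟨Q * MvPolynomial.X (1 - i), fun z => ?_⟩
    rw [polyFun_mul, polyFun_mul, hQ, map_mul]
    congr 1
    fin_cases i
    · exact (polyFun_X_one z).trans (congrArg _ (polyFun_X_zero z).symm)
    · exact (polyFun_X_zero z).trans
        ((Complex.conj_conj z).symm.trans (congrArg _ (polyFun_X_one z).symm))

theorem wordMap_affine {N : ℕ} {c : ℝ} {a b : Fin N → ℂ} (ha : ∀ k, ‖a k‖ = c) {m : ℕ}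
    (ω : Fin m → Fin N) : ∃ A B : ℂ, ‖A‖ = c ^ m ∧ ∀ z, wordMap a b ω z = A * z + B := by
  induction m with
  | zero => exact ⟨1, 0, by simp, fun z => by simp [wordMap]⟩
  | succ m ih =>
    obtain ⟨A, B, hA, h⟩ := ih (Fin.tail ω)
    refine ⟨a (ω 0) * A, a (ω 0) * B + b (ω 0), ?_, fun z => ?_⟩
    · rw [norm_mul, hA, ha, pow_succ']
    · simp only [wordMap, h]; ring

theorem wordMap_polygon_subset {N : ℕ} {c : ℝ} {a b : Fin N → ℂ} {E : Set ℂ}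
    (hE : IsGeneratedBy c a b p E) {m : ℕ} (ω : Fin m → Fin N) :
    wordMap a b ω '' polygon p ⊆ E := by
  conv_rhs => rw [hE.decomposition]
  exact (subset_iUnion₂ (s := fun (m : ℕ) (ω : Fin m → Fin N) => wordMap a b ω '' polygon p) m
    ω).trans subset_closure

/-- The image of `κ_ω` lies in the compact set `E`, so `P` and its derivative are bounded on it
uniformly in `ω`. -/
theorem sidePoint_wordMap_mem {N : ℕ} {c : ℝ} {a b : Fin N → ℂ} {E : Set ℂ}
    (hE : IsGeneratedBy c a b p E) (hper : ∑ l, sideLength p l = 2 * Real.pi) {m : ℕ}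
    (ω : Fin m → Fin N) {j : Fin M} {t : ℝ}
    (ht : t ∈ Icc (angle p j) (angle p j + sideLength p j)) :
    sidePoint p (fun j => wordMap a b ω (p j)) j t ∈ E := by
  obtain ⟨A, B, -, h⟩ := wordMap_affine (b := b) hE.ratio_eq ω
  refine wordMap_polygon_subset hE ω ⟨sidePoint p p j t, mem_iUnion.2 ⟨j, ?_⟩, ?_⟩
  · rw [segment_eq_image']
    refine ⟨sideParam p j t, sideParam_mem hE.jordan hper ht, ?_⟩
    simp only [sidePoint]
    rw [Complex.real_smul, mul_comm]
  · simp only [h, sidePoint]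
    ring

/-- The derivative with respect to the angle of `P ∘ κ_ω` is at most a constant times `c ^ m`,
because `κ_ω` is the composition of `κ_∅` with a similarity of ratio `c ^ m`; and it has the Fourier
coefficients of the derivative although it is only defined arc by arc. -/
theorem exists_symbol {N : ℕ} {c : ℝ} {a b : Fin N → ℂ} {E : Set ℂ}
    (hE : IsGeneratedBy c a b p E) (hper : ∑ l, sideLength p l = 2 * Real.pi)
    (P : MvPolynomial (Fin 2) ℂ) : ∃ K K' : ℝ, 0 ≤ K ∧ 0 ≤ K' ∧ ∀ ω : Word N, ∃ g g' : ℝ → ℂ,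
      Measurable g ∧ Measurable g' ∧ (∀ t, ‖g t‖ ≤ K) ∧ (∀ t, ‖g' t‖ ≤ K' * c ^ ω.1) ∧
      polyFun P ∘ wordKappa c a b p ω =ᵐ[circleMeasure (c ^ ω.1)] g ∘ circleAngle ∧
      ∀ n : ℤ, ∫ t in (0 : ℝ)..2 * Real.pi, g' t * Complex.exp (Complex.I * n * t) =
        -(Complex.I * n) *
          ∫ t in (0 : ℝ)..2 * Real.pi, g t * Complex.exp (Complex.I * n * t) := by
  have hc := hE.ratio_pos
  have hP := contDiff_polyFun P
  have hfd : Continuous (fderiv ℝ (polyFun P)) := hP.continuous_fderiv one_ne_zero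
  obtain ⟨K, hK⟩ := hE.attractor_compact.exists_bound_of_continuousOn hP.continuous.continuousOn
  obtain ⟨K₁, hK₁⟩ := hE.attractor_compact.exists_bound_of_continuousOn hfd.continuousOn
  have hKpos : 0 ≤ K := by
    obtain ⟨x, hx⟩ := hE.attractor_nonempty
    exact (norm_nonneg _).trans (hK x hx)
  have hK₁pos : 0 ≤ K₁ := by
    obtain ⟨x, hx⟩ := hE.attractor_nonempty
    exact (norm_nonneg _).trans (hK₁ x hx)
  -- `S j` bounds the speed of the parametrization of the `j`-th side of the original polygon.
  let S : Fin M → ℝ := fun j =>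
    sideLength p j * |sideParamDeriv p j (angle p j + sideLength p j)|
  have hSpos : 0 ≤ ∑ j, S j :=
    Finset.sum_nonneg fun j _ => mul_nonneg (norm_nonneg _) (abs_nonneg _)
  refine ⟨K, K₁ * ∑ j, S j, hKpos, mul_nonneg hK₁pos hSpos, fun ω => ?_⟩
  obtain ⟨A, B, hA, hAB⟩ := wordMap_affine (b := b) hE.ratio_eq ω.2
  set q : Fin M → ℂ := fun j => wordMap a b ω.2 (p j) with hq
  have hqd : ∀ j, ‖q (j + 1) - q j‖ = c ^ ω.1 * sideLength p j := fun j => by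
    simp only [hq, hAB]
    rw [sideLength, ← hA, ← norm_mul]
    congr 1
    ring
  let G : Fin M → ℝ → ℂ := fun j t => polyFun P (sidePoint p q j t)
  let G' : Fin M → ℝ → ℂ := fun j t =>
    fderiv ℝ (polyFun P) (sidePoint p q j t) ((q (j + 1) - q j) * sideParamDeriv p j t)
  have hsm : ∀ j, Measurable (sidePoint p q j) := fun j =>
    ((Complex.measurable_ofReal.comp (measurable_sideParam j)).const_mul _).const_add _
  have hGm : ∀ j, Measurable (G j) := fun j => hP.continuous.measurable.comp (hsm j)
  have hGm' : ∀ j, Measurable (G' j) := fun j => by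
    have h1 : Continuous fun x : ℂ × ℂ => fderiv ℝ (polyFun P) x.1 x.2 :=
      (hfd.comp continuous_fst).clm_apply continuous_snd
    exact h1.measurable.comp ((hsm j).prodMk
      ((Complex.measurable_ofReal.comp (measurable_sideParamDeriv j)).const_mul _))
  have hmem : ∀ j, ∀ t ∈ Icc (angle p j) (angle p j + sideLength p j), sidePoint p q j t ∈ E :=
    fun j t ht => sidePoint_wordMap_mem hE hper ω.2 ht
  have hG : ∀ j, ∀ t ∈ Icc (angle p j) (angle p j + sideLength p j), ‖G j t‖ ≤ K :=
    fun j t ht => hK _ (hmem j t ht)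
  have hG' : ∀ j, ∀ t ∈ Icc (angle p j) (angle p j + sideLength p j),
      ‖G' j t‖ ≤ K₁ * (∑ j, S j) * c ^ ω.1 := by
    intro j t ht
    refine (ContinuousLinearMap.le_of_opNorm_le _ (hK₁ _ (hmem j t ht)) _).trans ?_
    rw [norm_mul, hqd, Complex.norm_real, Real.norm_eq_abs, mul_assoc K₁]
    refine mul_le_mul_of_nonneg_left ?_ hK₁pos
    have h1 : sideLength p j * |sideParamDeriv p j t| ≤ ∑ j, S j := by
      refine le_trans ?_ (Finset.single_le_sum (f := S)
        (fun j _ => mul_nonneg (norm_nonneg _) (abs_nonneg _)) (Finset.mem_univ j))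
      exact mul_le_mul_of_nonneg_left
        ((abs_sideParamDeriv_le hE.jordan hper ht).trans (le_abs_self _)) (norm_nonneg _)
    calc c ^ ω.1 * sideLength p j * |sideParamDeriv p j t|
        = c ^ ω.1 * (sideLength p j * |sideParamDeriv p j t|) := by ring
      _ ≤ c ^ ω.1 * ∑ j, S j := mul_le_mul_of_nonneg_left h1 (by positivity)
      _ = _ := mul_comm _ _
  have hd : ∀ j, ∀ t ∈ Icc (angle p j) (angle p j + sideLength p j),
      HasDerivAt (G j) (G' j t) t := by
    intro j t ht
    have h1 : HasDerivAt (sidePoint p q j) ((q (j + 1) - q j) * sideParamDeriv p j t) t :=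
      ((hasDerivAt_sideParam hE.jordan hper ht).ofReal_comp.const_mul _).const_add _
    exact ((hP.differentiable one_ne_zero).differentiableAt.hasFDerivAt).comp_hasDerivAt t h1
  refine ⟨arcSum p G, arcSum p G', measurable_arcSum hGm, measurable_arcSum hGm',
    norm_arcSum_le hKpos hG, norm_arcSum_le (by positivity) hG', ?_, ?_⟩
  · filter_upwards [ae_norm_eq (c ^ ω.1)] with z hz
    rw [abs_of_pos (pow_pos hc _)] at hz
    obtain ⟨j, hj⟩ := exists_arc hper (circleAngle_mem z)
    rw [Function.comp_apply, Function.comp_apply, wordKappa,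
      kappa_eq_arcSum hE.jordan hper (pow_pos hc _) hz, arcSum_eq _ hj, arcSum_eq _ hj]
  · refine integral_arcSum_deriv hper hGm hGm' hKpos (by positivity) hG hG' hd
      (v := fun j => polyFun P (q j)) (fun j => ?_) (fun j => ?_)
    · simp only [G, sidePoint, sideParam_left]
      simp
    · simp only [G, sidePoint, sideParam_right hE.jordan hper]
      simp

end Symbols

/-! ### The spectral triple -/

section Triple

variable {N M : ℕ} [NeZero M] {c : ℝ} {a b : Fin N → ℂ} {p : Fin M → ℂ} {E : Set ℂ}

theorem exists_norm_toeplitz_le (hE : IsGeneratedBy c a b p E)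
    (hper : ∑ l, sideLength p l = 2 * Real.pi) (P : MvPolynomial (Fin 2) ℂ) :
    ∃ K : ℝ, 0 ≤ K ∧ ∀ ω : Word N,
      MemLp (polyFun P ∘ wordKappa c a b p ω) ∞ (circleMeasure (c ^ ω.1)) ∧
      ‖toeplitz (c ^ ω.1) (polyFun P ∘ wordKappa c a b p ω)‖ ≤ K := by
  obtain ⟨K, K', hK, -, h⟩ := exists_symbol hE hper P
  refine ⟨K, hK, fun ω => ?_⟩
  obtain ⟨g, g', hg, -, hgK, -, hgu, -⟩ := h ω
  refine ⟨(memLp_congr_ae hgu).2 (memLp_comp_circleAngle hg hgK), ?_⟩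
  rw [toeplitz_congr hgu]
  exact norm_toeplitz_le hK (.of_forall fun _ => hgK _)

theorem star_sumToeplitz (hE : IsGeneratedBy c a b p E)
    (hper : ∑ l, sideLength p l = 2 * Real.pi) (P : MvPolynomial (Fin 2) ℂ) :
    ∃ Q, star (sumToeplitz c a b p P) = sumToeplitz c a b p Q := by
  obtain ⟨Q, hQ⟩ := exists_polyFun_conj P
  obtain ⟨K, hK, h⟩ := exists_norm_toeplitz_le hE hper P
  refine ⟨Q, ?_⟩
  rw [sumToeplitz, star_directSum hK fun ω => (h ω).2, sumToeplitz]
  congr 1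
  funext ω
  rw [star_toeplitz (pow_pos hE.ratio_pos _) (h ω).1]
  congr 1
  funext z
  exact (hQ _).symm

theorem star_mem_adjoin {H : Type*} [NormedAddCommGroup H] [InnerProductSpace ℂ H]
    [CompleteSpace H] {S : Set (H →L[ℂ] H)} (hS : ∀ T ∈ S, star T ∈ S) {T : H →L[ℂ] H}
    (hT : T ∈ Algebra.adjoin ℂ S) : star T ∈ Algebra.adjoin ℂ S := by
  induction hT using Algebra.adjoin_induction with
  | mem T hT => exact Algebra.subset_adjoin (hS T hT)
  | algebraMap x =>
    rw [← algebraMap_star_comm]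
    exact Subalgebra.algebraMap_mem _ _
  | add T T' _ _ h h' => rw [star_add]; exact add_mem h h'
  | mul T T' _ _ h h' => rw [star_mul]; exact mul_mem h' h

theorem star_mem_sumAlgebra (hE : IsGeneratedBy c a b p E)
    (hper : ∑ l, sideLength p l = 2 * Real.pi) {T : SumSpace c N →L[ℂ] SumSpace c N}
    (hT : T ∈ sumAlgebra c a b p) : star T ∈ sumAlgebra c a b p := by
  refine star_mem_adjoin ?_ hT
  rintro _ ⟨P, rfl⟩
  obtain ⟨Q, hQ⟩ := star_sumToeplitz hE hper P
  exact ⟨Q, hQ.symm⟩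

theorem norm_smul_clm_le {H : Type*} [NormedAddCommGroup H] [InnerProductSpace ℂ H] (x : ℂ)
    (T : H →L[ℂ] H) : ‖x • T‖ ≤ ‖x‖ * ‖T‖ :=
  norm_smul_le x T

/-- The commutator of a generator with the Dirac operator is the direct sum of Toeplitz operators
with symbols of size `c⁻ᵐ * O(cᵐ)`. -/
theorem exists_commutator_sumToeplitz (hE : IsGeneratedBy c a b p E)
    (hper : ∑ l, sideLength p l = 2 * Real.pi) (P : MvPolynomial (Fin 2) ℂ) (β : ℕ → ℝ) :
    ∃ C : SumSpace c N →L[ℂ] SumSpace c N,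
      ∀ v : (sumDirac c N (fun m => (c ^ m)⁻¹) β).closure.domain,
        (sumToeplitz c a b p P v, C v + sumToeplitz c a b p P
          ((sumDirac c N (fun m => (c ^ m)⁻¹) β).closure v)) ∈
            (sumDirac c N (fun m => (c ^ m)⁻¹) β).closure.graph := by
  have hc := hE.ratio_pos
  obtain ⟨K, K', hK, hK', h⟩ := exists_symbol hE hper P
  choose g g' hg hg' hgK hgK' hgu hF using h
  let T : ∀ ω : Word N, WordSpace c ω →L[ℂ] WordSpace c ω := fun ω =>
    toeplitz (c ^ ω.1) (polyFun P ∘ wordKappa c a b p ω)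
  let C : ∀ ω : Word N, WordSpace c ω →L[ℂ] WordSpace c ω := fun ω =>
    (-Complex.I * (((c ^ ω.1)⁻¹ : ℝ) : ℂ)) • toeplitz (c ^ ω.1) (g' ω ∘ circleAngle)
  have hT : ∀ ω, T ω = toeplitz (c ^ ω.1) (g ω ∘ circleAngle) := fun ω => toeplitz_congr (hgu ω)
  have hTK : ∀ ω, ‖T ω‖ ≤ K := fun ω => by
    rw [hT]
    exact norm_toeplitz_le hK (.of_forall fun _ => hgK ω _)
  have hCK : ∀ ω, ‖C ω‖ ≤ K' := fun ω => by
    have hcm : 0 < c ^ ω.1 := pow_pos hc _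
    have h1 : ‖toeplitz (c ^ ω.1) (g' ω ∘ circleAngle)‖ ≤ K' * c ^ ω.1 :=
      norm_toeplitz_le (by positivity) (.of_forall fun _ => hgK' ω _)
    refine (norm_smul_clm_le (-Complex.I * (((c ^ ω.1)⁻¹ : ℝ) : ℂ))
      (toeplitz (c ^ ω.1) (g' ω ∘ circleAngle))).trans ?_
    rw [norm_mul, norm_neg, Complex.norm_I, one_mul, Complex.norm_real,
      Real.norm_of_nonneg (by positivity)]
    calc (c ^ ω.1)⁻¹ * ‖toeplitz (c ^ ω.1) (g' ω ∘ circleAngle)‖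
        ≤ (c ^ ω.1)⁻¹ * (K' * c ^ ω.1) := by gcongr
      _ = K' := by field_simp
  refine ⟨directSum C, (isDiagonal_sumDirac hc _ β).commutator ?_⟩
  refine commutator_directSum (lam := fun (ω : Word N) (k : ℕ) => (c ^ ω.1)⁻¹ * k + β ω.1)
    (T := T) (C := C) hK hTK hK' hCK fun ω j k => ?_
  rw [hT]
  exact inner_toeplitz_commutator (pow_pos hc _) (hg ω) (hgK ω) (hg' ω) (hgK' ω) _ _ (hF ω) j k

/-- The operators which preserve the domain of `D` and have a bounded commutator with it form an
algebra, by the Leibniz rule. -/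
theorem exists_commutator_of_mem_adjoin {H : Type*} [NormedAddCommGroup H] [InnerProductSpace ℂ H]
    {D : H →ₗ.[ℂ] H} {S : Set (H →L[ℂ] H)}
    (hS : ∀ T ∈ S, ∃ C : H →L[ℂ] H, ∀ v : D.domain, (T v, C v + T (D v)) ∈ D.graph)
    {T : H →L[ℂ] H} (hT : T ∈ Algebra.adjoin ℂ S) :
    ∃ C : H →L[ℂ] H, ∀ v : D.domain, (T v, C v + T (D v)) ∈ D.graph := by
  induction hT using Algebra.adjoin_induction with
  | mem T hT => exact hS T hT
  | algebraMap x =>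
    refine ⟨0, fun v => ?_⟩
    have := D.graph.smul_mem x (D.mem_graph v)
    simpa [Algebra.algebraMap_eq_smul_one] using this
  | add T T' _ _ h h' =>
    obtain ⟨C, hC⟩ := h
    obtain ⟨C', hC'⟩ := h'
    refine ⟨C + C', fun v => ?_⟩
    have := D.graph.add_mem (hC v) (hC' v)
    simp only [Prod.mk_add_mk] at this
    simp only [add_apply]
    convert this using 2
    abel
  | mul T T' _ _ h h' =>
    obtain ⟨C, hC⟩ := h
    obtain ⟨C', hC'⟩ := h'
    refine ⟨C * T' + T * C', fun v => ?_⟩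
    obtain ⟨u, hu1, hu2⟩ := (LinearPMap.mem_graph_iff _).1 (hC' v)
    have := hC u
    simp only at hu1 hu2
    rw [hu1, hu2, map_add] at this
    change (T (T' v), (C (T' v) + T (C' v)) + T (T' (D v))) ∈ D.graph
    rwa [add_assoc]

theorem isSpectralTriple_sumDirac (hE : IsGeneratedBy c a b p E)
    (hper : ∑ l, sideLength p l = 2 * Real.pi) (hcN : 1 < c * (N : ℝ)) :
    IsSpectralTriple (sumAlgebra c a b p)
        (sumDirac c N (fun m => (c ^ m)⁻¹) fun m => (c ^ m)⁻¹).closure ∧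
      HasSpectralDimension (sumDirac c N (fun m => (c ^ m)⁻¹) fun m => (c ^ m)⁻¹).closure
        (Real.log N / Real.log (1 / c)) := by
  have hc := hE.ratio_pos
  have hc1 := hE.ratio_lt_one
  set D := sumDirac c N (fun m => (c ^ m)⁻¹) fun m => (c ^ m)⁻¹ with hDdef
  have hD : IsDiagonal (wordBasis hc N)
      (fun x : Word N × ℕ => (c ^ x.1.1)⁻¹ * x.2 + (c ^ x.1.1)⁻¹) D :=
    isDiagonal_sumDirac hc (fun m => (c ^ m)⁻¹) fun m => (c ^ m)⁻¹
  have hge : ∀ x : Word N × ℕ, 1 ≤ (c ^ x.1.1)⁻¹ * x.2 + (c ^ x.1.1)⁻¹ := fun x => by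
    have h1 : 1 ≤ (c ^ x.1.1)⁻¹ := (one_le_inv₀ (pow_pos hc _)).2 (pow_le_one₀ hc.le hc1.le)
    have h2 : 0 ≤ (c ^ x.1.1)⁻¹ * (x.2 : ℝ) := by positivity
    linarith
  have hpos : ∀ x : Word N × ℕ, 0 < (c ^ x.1.1)⁻¹ * x.2 + (c ^ x.1.1)⁻¹ :=
    fun x => zero_lt_one.trans_le (hge x)
  have hN : 1 ≤ (N : ℝ) := by
    have hN0 : 0 ≤ (N : ℝ) := Nat.cast_nonneg N
    nlinarith
  have hd0 : 0 ≤ Real.log N / Real.log (1 / c) :=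
    div_nonneg (Real.log_nonneg hN)
      (Real.log_nonneg (by rw [le_div_iff₀ hc]; linarith))
  obtain ⟨B, hB⟩ := exists_diagonal (wordBasis hc N)
    (ρ := fun x : Word N × ℕ => ((((c ^ x.1.1)⁻¹ * x.2 + (c ^ x.1.1)⁻¹ : ℝ) : ℂ))⁻¹) zero_le_one
    fun x => by
      rw [norm_inv, Complex.norm_real, Real.norm_of_nonneg (hpos x).le]
      exact inv_le_one_of_one_le₀ (hge x)
  have hcomm : ∀ T ∈ sumAlgebra c a b p, ∃ C : SumSpace c N →L[ℂ] SumSpace c N,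
      ∀ v : D.closure.domain, (T v, C v + T (D.closure v)) ∈ D.closure.graph := by
    refine fun T hT => exists_commutator_of_mem_adjoin ?_ hT
    rintro _ ⟨P, rfl⟩
    exact exists_commutator_sumToeplitz hE hper P _
  refine ⟨⟨fun T hT => star_mem_sumAlgebra hE hper hT, hD.isSelfAdjoint_closure,
    hD.hasCompactResolvent hpos ?_ hB, fun T hT v hv => ?_, fun T hT => ?_⟩,
    hD.hasSpectralDimension hpos hB hd0 fun s _ => tsum_eigenvalue_lt_top_iff hc hc1 hcN s⟩
  · refine tendsto_atTop_of_tsum_lt_top hpos (s := Real.log N / Real.log (1 / c) + 1)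
      (by linarith) ((tsum_eigenvalue_lt_top_iff hc hc1 hcN _).2 (by linarith))
  · obtain ⟨C, hC⟩ := hcomm T hT
    exact LinearPMap.mem_domain_of_mem_graph (hC ⟨v, hv⟩)
  · obtain ⟨C, hC⟩ := hcomm T hT
    refine ⟨C, fun v h => ?_⟩
    obtain ⟨u, hu1, hu2⟩ := (LinearPMap.mem_graph_iff _).1 (hC v)
    have hu : (⟨T v, h⟩ : D.closure.domain) = u := Subtype.ext hu1.symm
    rw [hu, hu2]
    simp

end Triple

/-! ### The Hausdorff dimension of the attractor -/

section Dimension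

variable {N M : ℕ} [NeZero M] {c : ℝ} {a b : Fin N → ℂ} {p : Fin M → ℂ} {E : Set ℂ}

theorem dist_wordMap (ha : ∀ k, ‖a k‖ = c) {m : ℕ} (ω : Fin m → Fin N) (z w : ℂ) :
    dist (wordMap a b ω z) (wordMap a b ω w) = c ^ m * dist z w := by
  obtain ⟨A, B, hA, h⟩ := wordMap_affine (b := b) ha ω
  rw [h, h, dist_eq_norm, dist_eq_norm, ← hA, ← norm_mul]
  congr 1
  ring

theorem wordMap_init {m : ℕ} (ω : Fin (m + 1) → Fin N) (z : ℂ) :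
    wordMap a b ω z =
      wordMap a b (Fin.init ω) (a (ω (Fin.last m)) * z + b (ω (Fin.last m))) := by
  induction m with
  | zero => simp [wordMap]
  | succ m ih =>
    have h := ih (Fin.tail ω)
    have h1 : wordMap a b ω z = a (ω 0) * wordMap a b (Fin.tail ω) z + b (ω 0) := rfl
    have h2 : ∀ y, wordMap a b (Fin.init ω) y =
      a (ω 0) * wordMap a b (Fin.tail (Fin.init ω)) y + b (ω 0) := fun y => rfl
    rw [h1, h, h2, Fin.tail_init_eq_init_tail]
    rfl

theorem map_mem_attractor (hE : IsGeneratedBy c a b p E) (k : Fin N) {z : ℂ} (hz : z ∈ E) :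
    a k * z + b k ∈ E :=
  hE.attractor_eq.symm.subset (mem_iUnion.2 ⟨k, z, hz, rfl⟩)

theorem wordMap_mem_attractor (hE : IsGeneratedBy c a b p E) {m : ℕ} (ω : Fin m → Fin N) {z : ℂ}
    (hz : z ∈ E) : wordMap a b ω z ∈ E := by
  induction m with
  | zero => exact hz
  | succ m ih => exact map_mem_attractor hE (ω 0) (ih (Fin.tail ω))

theorem exists_wordMap_eq (hE : IsGeneratedBy c a b p E) (m : ℕ) {z : ℂ} (hz : z ∈ E) :
    ∃ ω : Fin m → Fin N, z ∈ wordMap a b ω '' E := by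
  induction m generalizing z with
  | zero => exact ⟨Fin.elim0, z, hz, rfl⟩
  | succ m ih =>
    rw [hE.attractor_eq] at hz
    obtain ⟨k, y, hy, rfl⟩ := mem_iUnion.1 hz
    obtain ⟨ω, x, hx, rfl⟩ := ih hy
    refine ⟨Fin.cons k ω, x, hx, ?_⟩
    simp [wordMap]

theorem wordMap_image_subset {V : Set ℂ} (hV : ∀ k, (fun z => a k * z + b k) '' V ⊆ V) {m : ℕ}
    (ω : Fin m → Fin N) : wordMap a b ω '' V ⊆ V := by
  induction m with
  | zero => exact (image_id V).subset
  | succ m ih =>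
    rintro _ ⟨z, hz, rfl⟩
    exact hV (ω 0) ⟨_, ih (Fin.tail ω) ⟨z, hz, rfl⟩, rfl⟩

theorem disjoint_wordMap_image (ha : ∀ k, a k ≠ 0) {V : Set ℂ}
    (hV : ∀ k, (fun z => a k * z + b k) '' V ⊆ V)
    (hdis : Pairwise fun k l =>
      Disjoint ((fun z => a k * z + b k) '' V) ((fun z => a l * z + b l) '' V))
    {m : ℕ} {ω η : Fin m → Fin N} (h : ω ≠ η) :
    Disjoint (wordMap a b ω '' V) (wordMap a b η '' V) := by
  induction m with
  | zero => exact absurd (Subsingleton.elim ω η) h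
  | succ m ih =>
    have himg : ∀ ω : Fin (m + 1) → Fin N, wordMap a b ω '' V =
        (fun z => a (ω 0) * z + b (ω 0)) '' (wordMap a b (Fin.tail ω) '' V) := fun ω => by
      rw [image_image]; rfl
    rw [himg, himg]
    by_cases h0 : ω 0 = η 0
    · rw [← h0]
      refine (disjoint_image_iff fun x y hxy => ?_).2 (ih fun ht => h ?_)
      · exact mul_left_cancel₀ (ha (ω 0)) (add_right_cancel hxy)
      · rw [← Fin.cons_self_tail ω, ← Fin.cons_self_tail η, h0, ht]
    · exact (hdis h0).mono (image_mono (wordMap_image_subset hV _))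
        (image_mono (wordMap_image_subset hV _))

open Classical in
/-- The words of length `m` whose cell `F_ω(E)` meets the set `U`. -/
def hitWords (a b : Fin N → ℂ) (E U : Set ℂ) (m : ℕ) : Finset (Fin m → Fin N) :=
  {ω | (wordMap a b ω '' E ∩ U).Nonempty}

theorem mem_hitWords {U : Set ℂ} {m : ℕ} {ω : Fin m → Fin N} :
    ω ∈ hitWords a b E U m ↔ (wordMap a b ω '' E ∩ U).Nonempty := by
  simp [hitWords]

theorem ball_subset_wordMap_image (hc : 0 < c) (ha : ∀ k, ‖a k‖ = c) {m : ℕ} (ω : Fin m → Fin N)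
    (x : ℂ) (ρ : ℝ) :
    Metric.ball (wordMap a b ω x) (c ^ m * ρ) ⊆ wordMap a b ω '' Metric.ball x ρ := by
  intro z hz
  obtain ⟨A, B, hA, h⟩ := wordMap_affine (b := b) ha ω
  have hcm : 0 < c ^ m := pow_pos hc m
  have hA0 : A ≠ 0 := norm_pos_iff.1 (hA ▸ hcm)
  have hz' : wordMap a b ω ((z - B) / A) = z := by rw [h]; field_simp; ring
  refine ⟨(z - B) / A, ?_, hz'⟩
  rw [Metric.mem_ball] at hz ⊢
  rw [← hz', dist_wordMap ha] at hz
  exact lt_of_mul_lt_mul_left hz hcm.le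

/-- A set of diameter comparable to `c ^ m` meets a bounded number of cells of level `m`: by the
open set condition each of these cells lies near a disk of radius comparable to `c ^ m`, and these
disks are disjoint. -/
theorem exists_card_hitWords_le (hE : IsGeneratedBy c a b p E) :
    ∃ K : ℕ, 0 < K ∧ ∀ (m : ℕ) (U : Set ℂ), (∀ x ∈ U, ∀ y ∈ U, dist x y ≤ 2 * c ^ m) →
      (hitWords a b E U m).card ≤ K := by
  have hc := hE.ratio_pos
  obtain ⟨V, ⟨x₀, hx₀⟩, hVo, -, hV, hdis⟩ := hE.open_set_condition
  obtain ⟨ρ, hρ, hball⟩ := Metric.isOpen_iff.1 hVo x₀ hx₀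
  obtain ⟨D, hD⟩ := hE.attractor_compact.isBounded.subset_closedBall x₀
  have hD0 : 0 ≤ D := by
    obtain ⟨y, hy⟩ := hE.attractor_nonempty
    exact dist_nonneg.trans (hD hy)
  have ha0 : ∀ k, a k ≠ 0 := fun k => norm_pos_iff.1 (hE.ratio_eq k ▸ hc)
  set R := D + 2 + ρ with hR
  refine ⟨⌈R ^ 2 / ρ ^ 2⌉₊ + 1, Nat.succ_pos _, fun m U hU => ?_⟩
  have hcm : 0 < c ^ m := pow_pos hc m
  rcases (hitWords a b E U m).eq_empty_or_nonempty with h0 | ⟨ω₀, hω₀⟩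
  · rw [h0]; simp
  obtain ⟨u₀, -, hu₀⟩ := mem_hitWords.1 hω₀
  have hsub : ⋃ ω ∈ hitWords a b E U m, Metric.ball (wordMap a b ω x₀) (c ^ m * ρ) ⊆
      Metric.ball u₀ (c ^ m * R) := by
    refine iUnion₂_subset fun ω hω => Metric.ball_subset_ball' ?_
    obtain ⟨u, ⟨y, hy, rfl⟩, hu⟩ := mem_hitWords.1 hω
    have h1 : dist (wordMap a b ω x₀) (wordMap a b ω y) ≤ c ^ m * D := by
      rw [dist_wordMap hE.ratio_eq, dist_comm]
      exact mul_le_mul_of_nonneg_left (hD hy) hcm.le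
    have h2 := hU _ hu _ hu₀
    have h3 := dist_triangle (wordMap a b ω x₀) (wordMap a b ω y) u₀
    rw [hR]
    linarith
  have hpd : PairwiseDisjoint ((hitWords a b E U m : Finset _) : Set (Fin m → Fin N))
      fun ω => Metric.ball (wordMap a b ω x₀) (c ^ m * ρ) := fun ω _ η _ hne =>
    (disjoint_wordMap_image ha0 hV hdis hne).mono
      ((ball_subset_wordMap_image hc hE.ratio_eq ω x₀ ρ).trans (image_mono hball))
      ((ball_subset_wordMap_image hc hE.ratio_eq η x₀ ρ).trans (image_mono hball))
  have hvol := measure_mono (μ := volume) hsub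
  rw [measure_biUnion_finset hpd fun _ _ => measurableSet_ball] at hvol
  have hv : ∀ (z : ℂ) (s : ℝ), 0 ≤ s →
      volume (Metric.ball z (c ^ m * s)) = ENNReal.ofReal ((c ^ m * s) ^ 2 * Real.pi) :=
    fun z s hs => by
      rw [Complex.volume_ball, ENNReal.ofReal_mul (p := (c ^ m * s) ^ 2) (by positivity),
        ENNReal.ofReal_pow (p := c ^ m * s) (by positivity), ← NNReal.coe_real_pi,
        ENNReal.ofReal_coe_nnreal]
  simp only [hv _ _ hρ.le] at hvol
  rw [hv _ _ (by positivity), Finset.sum_const, nsmul_eq_mul, ← ENNReal.ofReal_natCast,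
    ← ENNReal.ofReal_mul (by positivity), ENNReal.ofReal_le_ofReal_iff (by positivity)] at hvol
  have hle : ((hitWords a b E U m).card : ℝ) ≤ R ^ 2 / ρ ^ 2 := by
    rw [le_div_iff₀ (by positivity)]
    have hpos : 0 < (c ^ m) ^ 2 * Real.pi := by positivity
    refine le_of_mul_le_mul_right ?_ hpos
    linarith
  have := hle.trans (Nat.le_ceil _)
  exact (Nat.cast_le.1 this).trans (Nat.le_succ _)

/-- A cell lies in the cell of the word without the last letter. -/
theorem card_hitWords_succ_le (hE : IsGeneratedBy c a b p E) (U : Set ℂ) (m : ℕ) :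
    (hitWords a b E U (m + 1)).card ≤ (hitWords a b E U m).card * N := by
  have h : (hitWords a b E U m ×ˢ (Finset.univ : Finset (Fin N))).card =
      (hitWords a b E U m).card * N := by
    rw [Finset.card_product, Finset.card_univ, Fintype.card_fin]
  rw [← h]
  refine Finset.card_le_card_of_injOn (fun ω => (Fin.init ω, ω (Fin.last m))) (fun ω hω => ?_) ?_
  · obtain ⟨_, ⟨y, hy, rfl⟩, hu⟩ := mem_hitWords.1 hω
    refine Finset.mem_product.2 ⟨mem_hitWords.2 ⟨wordMap a b ω y,
      ⟨_, map_mem_attractor hE (ω (Fin.last m)) hy, (wordMap_init ω y).symm⟩, hu⟩,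
      Finset.mem_univ _⟩
  · intro ω _ η _ heq
    rw [Prod.mk.injEq] at heq
    rw [← Fin.snoc_init_self ω, ← Fin.snoc_init_self η, heq.1, heq.2]

theorem card_hitWords_add_le (hE : IsGeneratedBy c a b p E) (U : Set ℂ) (m l : ℕ) :
    (hitWords a b E U (m + l)).card ≤ (hitWords a b E U m).card * N ^ l := by
  induction l with
  | zero => simp
  | succ l ih =>
    refine (card_hitWords_succ_le hE U (m + l)).trans ?_
    rw [pow_succ, ← mul_assoc]
    exact Nat.mul_le_mul_right N ih

/-- Counting the cells of a deep level: if finitely many sets of diameters comparable to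
`c ^ (m i)` cover `E`, then `∑ N ^ (-m i)` is bounded below. -/
theorem one_le_mul_sum_of_cover (hE : IsGeneratedBy c a b p E) (hN : 0 < N) {K : ℕ}
    (hK : ∀ (m : ℕ) (U : Set ℂ), (∀ x ∈ U, ∀ y ∈ U, dist x y ≤ 2 * c ^ m) →
      (hitWords a b E U m).card ≤ K)
    {ι : Type*} (s : Finset ι) (U : ι → Set ℂ) (m : ι → ℕ)
    (hU : ∀ i, ∀ x ∈ U i, ∀ y ∈ U i, dist x y ≤ 2 * c ^ m i) (hcov : E ⊆ ⋃ i ∈ s, U i) :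
    (1 : ℝ≥0∞) ≤ K * ∑ i ∈ s, ((N : ℝ≥0∞) ^ m i)⁻¹ := by
  classical
  have hN0 : (N : ℝ≥0∞) ≠ 0 := by exact_mod_cast hN.ne'
  have hNt : (N : ℝ≥0∞) ≠ ⊤ := ENNReal.natCast_ne_top N
  -- `n` is a level deeper than all the `m i`.
  set n := s.sup m with hn
  have h1 : N ^ n ≤ ∑ i ∈ s, K * N ^ (n - m i) := by
    have hcard : (Finset.univ : Finset (Fin n → Fin N)).card = N ^ n := by simp
    rw [← hcard]
    have hsub : (Finset.univ : Finset (Fin n → Fin N)) ⊆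
        s.biUnion fun i => hitWords a b E (U i) n := by
      intro ω _
      obtain ⟨y, hy⟩ := hE.attractor_nonempty
      obtain ⟨i, hi, hyi⟩ := mem_iUnion₂.1 (hcov (wordMap_mem_attractor hE ω hy))
      exact Finset.mem_biUnion.2 ⟨i, hi, mem_hitWords.2 ⟨_, ⟨y, hy, rfl⟩, hyi⟩⟩
    refine ((Finset.card_le_card hsub).trans Finset.card_biUnion_le).trans
      (Finset.sum_le_sum fun i hi => ?_)
    have h2 := card_hitWords_add_le hE (U i) (m i) (n - m i)
    rw [Nat.add_sub_cancel' (Finset.le_sup (f := m) hi)] at h2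
    exact h2.trans (Nat.mul_le_mul_right _ (hK _ _ (hU i)))
  have h3 : (N : ℝ≥0∞) ^ n ≤ (K * ∑ i ∈ s, ((N : ℝ≥0∞) ^ m i)⁻¹) * (N : ℝ≥0∞) ^ n := by
    calc (N : ℝ≥0∞) ^ n ≤ ∑ i ∈ s, (K : ℝ≥0∞) * (N : ℝ≥0∞) ^ (n - m i) := by exact_mod_cast h1
      _ = _ := by
        rw [Finset.mul_sum, Finset.sum_mul]
        refine Finset.sum_congr rfl fun i hi => ?_
        rw [mul_assoc]
        congr 1
        have hmi : n = m i + (n - m i) := (Nat.add_sub_cancel' (Finset.le_sup (f := m) hi)).symm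
        conv_rhs => rw [hmi, pow_add, ← mul_assoc,
          ENNReal.inv_mul_cancel (pow_ne_zero _ hN0) (ENNReal.pow_ne_top hNt), one_mul]
  rwa [← one_mul ((N : ℝ≥0∞) ^ n), ← mul_assoc, mul_one,
    ENNReal.mul_le_mul_iff_left (pow_ne_zero _ hN0) (ENNReal.pow_ne_top hNt)] at h3

/-- The similarity dimension `d` satisfies `c ^ d = 1 / N`. -/
theorem rpow_similarityDim (hc : 0 < c) (hc1 : c < 1) (hN : 0 < N) :
    c ^ (Real.log N / Real.log (1 / c)) = (N : ℝ)⁻¹ := by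
  have hl : Real.log c ≠ 0 := (Real.log_neg hc hc1).ne
  rw [Real.rpow_def_of_pos hc, one_div, Real.log_inv,
    ← Real.exp_log (Nat.cast_pos.2 hN : (0 : ℝ) < N), ← Real.exp_neg, Real.log_exp]
  congr 1
  field_simp

/-- A set `t` of diameter at most `1` lies in an open set of diameter at most `2 c ^ m`, where
`N ^ (-m)` is comparable to the contribution of `t` to the Hausdorff measure, up to an error `ε`. -/
theorem exists_open_enlargement (hc : 0 < c) (hc1 : c < 1) (hN : 2 ≤ N) {t : Set ℂ}
    (ht : Metric.ediam t ≤ ENNReal.ofReal 1) {ε : ℝ≥0∞} (hε : 0 < ε) :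
    ∃ (m : ℕ) (U : Set ℂ), IsOpen U ∧ t ⊆ U ∧ (∀ x ∈ U, ∀ y ∈ U, dist x y ≤ 2 * c ^ m) ∧
      ((N : ℝ≥0∞) ^ m)⁻¹ ≤
        N * (⨆ _ : t.Nonempty, Metric.ediam t ^ (Real.log N / Real.log (1 / c))) + ε := by
  have hN0 : 0 < N := by omega
  have hd : 0 < Real.log N / Real.log (1 / c) :=
    div_pos (Real.log_pos (by exact_mod_cast hN))
      (Real.log_pos (by rw [lt_div_iff₀ hc]; linarith))
  have hbdd : Metric.ediam t ≠ ⊤ := (ht.trans_lt ENNReal.ofReal_lt_top).ne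
  have key : ∀ m : ℕ, Metric.diam t ≤ c ^ m → ∀ x ∈ Metric.thickening (c ^ m / 2) t,
      ∀ y ∈ Metric.thickening (c ^ m / 2) t, dist x y ≤ 2 * c ^ m := by
    intro m hm x hx y hy
    obtain ⟨x', hx', hxx⟩ := Metric.mem_thickening_iff.1 hx
    obtain ⟨y', hy', hyy⟩ := Metric.mem_thickening_iff.1 hy
    have h1 := Metric.dist_le_diam_of_mem' hbdd hx' hy'
    have h2 := dist_triangle4 x x' y' y
    rw [dist_comm y' y] at h2
    linarith
  have hpos : ∀ m : ℕ, 0 < c ^ m / 2 := fun m => half_pos (pow_pos hc m)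
  -- For a set of diameter `0` the error `ε` leaves room for a large `m`; otherwise `m` is determined
  -- by `c ^ (m + 1) < diam t ≤ c ^ m`.
  rcases eq_or_lt_of_le (Metric.diam_nonneg (s := t)) with h0 | h0
  · have hlt : (N : ℝ≥0∞)⁻¹ < 1 := by
      rw [ENNReal.inv_lt_one]; exact_mod_cast hN
    obtain ⟨m, hm⟩ := ((ENNReal.tendsto_pow_atTop_nhds_zero_of_lt_one hlt).eventually_lt_const
      hε).exists
    refine ⟨m, _, Metric.isOpen_thickening, Metric.self_subset_thickening (hpos m) t,
      key m (h0 ▸ (pow_pos hc m).le), ?_⟩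
    rw [ENNReal.inv_pow]
    exact hm.le.trans le_add_self
  · have h1 : Metric.diam t ≤ 1 := ENNReal.toReal_le_of_le_ofReal zero_le_one ht
    obtain ⟨m, hm1, hm2⟩ := exists_nat_pow_near_of_lt_one h0 h1 hc hc1
    refine ⟨m, _, Metric.isOpen_thickening, Metric.self_subset_thickening (hpos m) t,
      key m hm2, ?_⟩
    have hne : t.Nonempty := by
      rw [nonempty_iff_ne_empty]
      rintro rfl
      simp at h0
    rw [iSup_pos hne, ← ENNReal.ofReal_toReal hbdd]
    change _ ≤ (N : ℝ≥0∞) * ENNReal.ofReal (Metric.diam t) ^ _ + ε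
    rw [ENNReal.ofReal_rpow_of_pos h0]
    have hreal : ((N : ℝ) ^ m)⁻¹ ≤ N * Metric.diam t ^ (Real.log N / Real.log (1 / c)) := by
      have h2 := Real.rpow_le_rpow (by positivity) hm1.le hd.le
      rw [← Real.rpow_natCast, ← Real.rpow_mul hc.le, mul_comm ((m + 1 : ℕ) : ℝ),
        Real.rpow_mul hc.le, rpow_similarityDim hc hc1 hN0, Real.rpow_natCast, inv_pow] at h2
      have hNr : (0 : ℝ) < N := Nat.cast_pos.2 hN0
      calc ((N : ℝ) ^ m)⁻¹ = N * ((N : ℝ) ^ (m + 1))⁻¹ := by field_simp; ring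
        _ ≤ _ := mul_le_mul_of_nonneg_left h2 hNr.le
    have hofReal : ((N : ℝ≥0∞) ^ m)⁻¹ = ENNReal.ofReal (((N : ℝ) ^ m)⁻¹) := by
      rw [ENNReal.ofReal_inv_of_pos (by positivity), ENNReal.ofReal_pow (by positivity),
        ENNReal.ofReal_natCast]
    rw [hofReal, ← ENNReal.ofReal_natCast, ← ENNReal.ofReal_mul (by positivity)]
    exact (ENNReal.ofReal_le_ofReal hreal).trans le_self_add

/-- Compactness reduces a countable cover of `E` to a finite one, for which the cells of a deep
level are counted. -/
theorem hausdorffMeasure_attractor_ne_zero (hE : IsGeneratedBy c a b p E) (hN : 2 ≤ N) :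
    μH[Real.log N / Real.log (1 / c)] E ≠ 0 := by
  have hc := hE.ratio_pos
  have hc1 := hE.ratio_lt_one
  set d := Real.log N / Real.log (1 / c) with hd
  obtain ⟨K, hK0, hK⟩ := exists_card_hitWords_le hE
  have hKe : (K : ℝ≥0∞) ≠ 0 := by exact_mod_cast hK0.ne'
  have hKt : (K : ℝ≥0∞) ≠ ⊤ := ENNReal.natCast_ne_top K
  have hNt : (N : ℝ≥0∞) ≠ ⊤ := ENNReal.natCast_ne_top N
  have hhalf : ((2 : ℝ≥0∞) * K)⁻¹ ≠ 0 := ENNReal.inv_ne_zero.2 (ENNReal.mul_ne_top (by simp) hKt)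
  obtain ⟨ε, hε, hεsum⟩ := ENNReal.exists_pos_sum_of_countable hhalf ℕ
  -- A smaller sum would give `1 ≤ K (N X + 1 / (2 K)) < 1 / 2 + 1 / 2`.
  have hlow : ∀ t : ℕ → Set ℂ, E ⊆ ⋃ n, t n → (∀ n, Metric.ediam (t n) ≤ ENNReal.ofReal 1) →
      ((2 : ℝ≥0∞) * K * N)⁻¹ ≤ ∑' n, ⨆ _ : (t n).Nonempty, Metric.ediam (t n) ^ d := by
    intro t hcov ht
    choose m U hUo htU hU hm using fun n =>
      exists_open_enlargement hc hc1 hN (ht n) (ENNReal.coe_pos.2 (hε n))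
    obtain ⟨s, hs⟩ := hE.attractor_compact.elim_finite_subcover U hUo
      (hcov.trans (iUnion_mono htU))
    have h1 := one_le_mul_sum_of_cover hE (by omega) hK s U m hU hs
    set X := ∑' n, ⨆ _ : (t n).Nonempty, Metric.ediam (t n) ^ d with hX
    have h2 : ∑ i ∈ s, ((N : ℝ≥0∞) ^ m i)⁻¹ ≤ N * X + (2 * K : ℝ≥0∞)⁻¹ := by
      calc _ ≤ ∑ i ∈ s, (N * (⨆ _ : (t i).Nonempty, Metric.ediam (t i) ^ d) + ε i) :=
            Finset.sum_le_sum fun i _ => hm i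
        _ = N * ∑ i ∈ s, (⨆ _ : (t i).Nonempty, Metric.ediam (t i) ^ d) +
            ∑ i ∈ s, (ε i : ℝ≥0∞) := by rw [Finset.sum_add_distrib, Finset.mul_sum]
        _ ≤ _ := add_le_add (mul_le_mul_right (ENNReal.sum_le_tsum s) _)
            ((ENNReal.sum_le_tsum s).trans hεsum.le)
    by_contra hlt
    rw [not_le] at hlt
    have h3 : (K : ℝ≥0∞) * (N * X) < 2⁻¹ := by
      have hKN : (K : ℝ≥0∞) * N ≠ 0 := mul_ne_zero hKe (by exact_mod_cast (by omega : N ≠ 0))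
      have hKNt : (K : ℝ≥0∞) * N ≠ ⊤ := ENNReal.mul_ne_top hKt hNt
      have := (ENNReal.mul_lt_mul_iff_right hKN hKNt).2 hlt
      rw [mul_assoc 2, ENNReal.mul_inv (by simp) (by simp), mul_left_comm,
        ENNReal.mul_inv_cancel hKN hKNt, mul_one] at this
      rwa [← mul_assoc]
    have h4 : (K : ℝ≥0∞) * (2 * K : ℝ≥0∞)⁻¹ = 2⁻¹ := by
      rw [ENNReal.mul_inv (by simp) (by simp), mul_left_comm, ENNReal.mul_inv_cancel hKe hKt,
        mul_one]
    have h5 := h1.trans (mul_le_mul_right h2 (K : ℝ≥0∞))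
    rw [mul_add, h4] at h5
    have h6 := ENNReal.add_lt_add_right (ENNReal.inv_ne_top.2 two_ne_zero) h3
    rw [ENNReal.inv_two_add_inv_two] at h6
    exact absurd h5 h6.not_ge
  have hpos : 0 < ((2 : ℝ≥0∞) * K * N)⁻¹ :=
    ENNReal.inv_pos.2 (ENNReal.mul_ne_top (ENNReal.mul_ne_top (by simp) hKt) hNt)
  refine (hpos.trans_le ?_).ne'
  rw [Measure.hausdorffMeasure_apply]
  exact le_iSup₂_of_le (ENNReal.ofReal 1) (by simp)
    (le_iInf fun t => le_iInf₂ fun h1 h2 => hlow t h1 h2)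

/-- The cells of level `m` are a cover by `N ^ m` sets of diameter at most `c ^ m diam E`. -/
theorem hausdorffMeasure_attractor_ne_top (hE : IsGeneratedBy c a b p E) (hN : 2 ≤ N) :
    μH[Real.log N / Real.log (1 / c)] E ≠ ⊤ := by
  have hc := hE.ratio_pos
  have hc1 := hE.ratio_lt_one
  set d := Real.log N / Real.log (1 / c) with hd
  have hd0 : 0 ≤ d := div_nonneg (Real.log_nonneg (by exact_mod_cast (by omega : 1 ≤ N)))
    (Real.log_nonneg (by rw [le_div_iff₀ hc]; linarith))
  set R := Metric.diam E with hR
  have hdiam : ∀ m (ω : Fin m → Fin N),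
      Metric.ediam (wordMap a b ω '' E) ≤ ENNReal.ofReal (c ^ m * R) := by
    intro m ω
    refine Metric.ediam_le ?_
    rintro _ ⟨x, hx, rfl⟩ _ ⟨y, hy, rfl⟩
    rw [edist_dist, dist_wordMap hE.ratio_eq]
    exact ENNReal.ofReal_le_ofReal (mul_le_mul_of_nonneg_left
      (Metric.dist_le_diam_of_mem hE.attractor_compact.isBounded hx hy) (by positivity))
  have hr : Filter.Tendsto (fun m : ℕ => ENNReal.ofReal (c ^ m * R)) Filter.atTop (nhds 0) := by
    have h := (tendsto_pow_atTop_nhds_zero_of_lt_one hc.le hc1).mul_const R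
    rw [zero_mul] at h
    simpa using ENNReal.tendsto_ofReal h
  have h1 := Measure.hausdorffMeasure_le_liminf_sum (X := ℂ) d E (l := Filter.atTop)
    (fun m : ℕ => ENNReal.ofReal (c ^ m * R)) hr
    (fun m (ω : Fin m → Fin N) => wordMap a b ω '' E) (.of_forall fun m ω => hdiam m ω)
    (.of_forall fun m z hz => mem_iUnion.2 (exists_wordMap_eq hE m hz))
  have hR0 : 0 ≤ R := Metric.diam_nonneg
  have h2 : ∀ m : ℕ, ∑ ω : Fin m → Fin N, Metric.ediam (wordMap a b ω '' E) ^ d ≤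
      ENNReal.ofReal (R ^ d) := by
    intro m
    calc _ ≤ ∑ _ω : Fin m → Fin N, ENNReal.ofReal ((c ^ m * R) ^ d) := by
          refine Finset.sum_le_sum fun ω _ => ?_
          rw [← ENNReal.ofReal_rpow_of_nonneg (by positivity) hd0]
          exact ENNReal.rpow_le_rpow (hdiam m ω) hd0
      _ = ENNReal.ofReal (R ^ d) := by
          rw [Finset.sum_const, nsmul_eq_mul, ← ENNReal.ofReal_natCast,
            ← ENNReal.ofReal_mul (by positivity)]
          congr 1
          have hNr : (N : ℝ) ≠ 0 := by exact_mod_cast (by omega : N ≠ 0)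
          rw [Real.mul_rpow (by positivity) hR0, ← Real.rpow_natCast, ← Real.rpow_mul hc.le,
            mul_comm (m : ℝ), Real.rpow_mul hc.le, rpow_similarityDim hc hc1 (by omega),
            Real.rpow_natCast]
          simp only [Finset.card_univ, Fintype.card_pi, Fintype.card_fin, Finset.prod_const,
            Nat.cast_pow, inv_pow]
          rw [← mul_assoc, mul_inv_cancel₀ (pow_ne_zero _ hNr), one_mul]
  refine (h1.trans_lt (lt_of_le_of_lt ?_ (ENNReal.ofReal_lt_top (r := R ^ d)))).ne
  exact (Filter.liminf_le_liminf (.of_forall h2)).trans (Filter.liminf_const _).le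

theorem dimH_attractor (hE : IsGeneratedBy c a b p E) (hN : 2 ≤ N) :
    dimH E = ENNReal.ofReal (Real.log N / Real.log (1 / c)) := by
  have hc := hE.ratio_pos
  have hd0 : 0 ≤ Real.log N / Real.log (1 / c) :=
    div_nonneg (Real.log_nonneg (by exact_mod_cast (by omega : 1 ≤ N)))
      (Real.log_nonneg (by rw [le_div_iff₀ hc]; linarith [hE.ratio_lt_one]))
  have h1 := hausdorffMeasure_attractor_ne_zero hE hN
  have h2 := hausdorffMeasure_attractor_ne_top hE hN
  rw [← Real.coe_toNNReal _ hd0] at h1 h2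
  exact dimH_of_hausdorffMeasure_ne_zero_ne_top h1 h2

end Dimension

end FractalTriple

end

theorem mainTheorem1 {N M : ℕ} [NeZero M] (c : ℝ) (a b : Fin N → ℂ) (p : Fin M → ℂ) (E : Set ℂ)
    (hE : FractalTriple.IsGeneratedBy c a b p E)
    (hperimeter : ∑ j, FractalTriple.sideLength p j = 2 * Real.pi)
    (hcN : 1 < c * (N : ℝ)) :
    (∀ α β : ℕ → ℝ, (∀ m, 0 < α m) → (∀ m, 0 < β m) →
      FractalTriple.IsEssentiallySelfAdjoint (FractalTriple.sumDirac c N α β)) ∧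
    dimH E = ENNReal.ofReal (Real.log N / Real.log (1 / c)) ∧
    ∃ α β : ℕ → ℝ, (∀ m, 0 < α m) ∧ (∀ m, 0 < β m) ∧
      FractalTriple.IsSpectralTriple (FractalTriple.sumAlgebra c a b p)
        (FractalTriple.sumDirac c N α β).closure ∧
      FractalTriple.HasSpectralDimension (FractalTriple.sumDirac c N α β).closure
        (dimH E).toReal := by
  have hc := hE.ratio_pos
  have hc1 := hE.ratio_lt_one
  have hN1 : (1 : ℝ) < N := by
    have hN0 : 0 ≤ (N : ℝ) := Nat.cast_nonneg N
    nlinarith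
  have hN : 2 ≤ N := by exact_mod_cast hN1
  have hdim := FractalTriple.dimH_attractor hE hN
  refine ⟨fun α β _ _ => (FractalTriple.isDiagonal_sumDirac hc α β).isEssentiallySelfAdjoint, hdim,
    fun m => (c ^ m)⁻¹, fun m => (c ^ m)⁻¹, fun m => inv_pos.2 (pow_pos hc m),
    fun m => inv_pos.2 (pow_pos hc m), ?_⟩
  have hd0 : 0 ≤ Real.log N / Real.log (1 / c) :=
    div_nonneg (Real.log_nonneg hN1.le)
      (Real.log_nonneg (by rw [le_div_iff₀ hc]; linarith))
  rw [hdim, ENNReal.toReal_ofReal hd0]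
  exact FractalTriple.isSpectralTriple_sumDirac hE hperimeter hcN
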